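/- Let $\mathcal D=\mathcal S(\mathbb R)\subset L^2(\mathbb R)$ be the Schwartz space, let $P=-i\,\frac{d}{dx}$, and let $H_0=P^2$ be the free Hamiltonian on $\mathcal D$; $e^{-isH_0}$ is the unitary operator on $L^2(\mathbb R)$ that is multiplication by $e^{-isp^2}$ in momentum space. Let $V:\mathbb R\to\mathbb R$ be a real potential that is defined on $\mathcal D$, i.e. $V\Phi\in L^2(\mathbb R)$ for all $\Phi\in\mathcal D$, and suppose that for every $t\ge 0$ there is a compact operator $C_t$ on $L^2(\mathbb R)$ such that $$\int_0^t \|V e^{-isH_0}\Phi\|^2\,ds\le\|C_t\Phi\|^2\qquad\text{for all }\Phi\in\mathcal D .$$ Then $H=H_0+V$ is essentially self-adjoint on $\mathcal D$, and, with $e^{itH}$ denoting the unique strongly continuous one-parameter unitary group generated by the closure of $H$ (that is, $\frac{d}{dt}e^{itH}\psi\,|_{t=0}=i\overline H\psi$ exactly for $\psi$ in the domain of $\overline H$), the operator $e^{itH}e^{-itH_0}-1$ is compact for every $t\in\mathbb R$. -/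

import Mathlib

open MeasureTheory SchwartzMap FourierTransform
open scoped ENNReal

noncomputable section

namespace SchrodingerPerturbation

/-- The Hilbert space `L²(ℝ)` of complex-valued functions. -/
abbrev L2 : Type := Lp (α := ℝ) ℂ 2 volume

/-- The linear operator in `L²(ℝ)` with domain the Schwartz space `𝒟` (regarded as a subspace of
`L²(ℝ)`) that sends the class of a Schwartz function `Φ` to `T Φ`. -/
def onSchwartz (T : 𝓢(ℝ, ℂ) →ₗ[ℂ] L2) : L2 →ₗ.[ℂ] L2 where
  domain := LinearMap.range (toLpCLM ℂ (E := ℝ) ℂ 2 volume).toLinearMap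
  toFun := T ∘ₗ (LinearEquiv.ofInjective (toLpCLM ℂ (E := ℝ) ℂ 2 volume).toLinearMap
    (injective_toLp 2 volume)).symm.toLinearMap

/-- The momentum operator `P = -i d/dx` on Schwartz functions. -/
def momentum : 𝓢(ℝ, ℂ) →ₗ[ℂ] 𝓢(ℝ, ℂ) :=
  (-Complex.I) • (derivCLM ℂ ℂ).toLinearMap

/-- The free Hamiltonian `H₀ = P²` as an operator in `L²(ℝ)` with domain `𝒟`. -/
def freeHamiltonian : L2 →ₗ.[ℂ] L2 :=
  onSchwartz ((toLpCLM ℂ (E := ℝ) ℂ 2 volume).toLinearMap ∘ₗ momentum ∘ₗ momentum)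

/-- The potential `V = V(Q)` is defined on `𝒟`: the product `V Φ` is in `L²(ℝ)` for every
Schwartz function `Φ`. -/
def DefinedOnSchwartz (V : ℝ → ℝ) : Prop :=
  ∀ Φ : 𝓢(ℝ, ℂ), MemLp (fun x => (V x : ℂ) * Φ x) 2 volume

/-- The operator of multiplication by `V` in `L²(ℝ)`, with domain `𝒟`. -/
def potential (V : ℝ → ℝ) (hV : DefinedOnSchwartz V) : L2 →ₗ.[ℂ] L2 :=
  onSchwartz
    { toFun := fun Φ => (hV Φ).toLp
      map_add' := fun Φ Ψ => by
        rw [← MemLp.toLp_add]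
        apply MemLp.toLp_congr
        filter_upwards with x
        simp [mul_add]
      map_smul' := fun c Φ => by
        rw [RingHom.id_apply, ← MemLp.toLp_const_smul]
        apply MemLp.toLp_congr
        filter_upwards with x
        simp [mul_left_comm] }

/-- The Hamiltonian `H = H₀ + V` with domain `𝒟`. -/
def hamiltonian (V : ℝ → ℝ) (hV : DefinedOnSchwartz V) : L2 →ₗ.[ℂ] L2 :=
  freeHamiltonian + potential V hV

/-- The function `ξ ↦ exp(i t (2πξ)²)`. With the normalization `𝓕 f (ξ) = ∫ e^{-2πixξ} f(x) dx`,
the momentum operator `P` is multiplication by `2πξ` in Fourier space. -/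
def freePhase (t : ℝ) (ξ : ℝ) : ℂ :=
  Complex.exp (Complex.I * ((t * (2 * Real.pi * ξ) ^ 2 : ℝ) : ℂ))

theorem memLp_freePhase (t : ℝ) : MemLp (freePhase t) ∞ (volume : Measure ℝ) := by
  refine memLp_top_of_bound (C := 1) ?_ ?_
  · have h : Continuous (freePhase t) := by
      unfold freePhase
      fun_prop
    exact h.aestronglyMeasurable
  · filter_upwards with ξ
    rw [freePhase, mul_comm, Complex.norm_exp_ofReal_mul_I]

/-- The unitary operator `e^{itH₀}` on `L²(ℝ)`, `H₀ = P²`, given by multiplication by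
`exp(i t p²)`, `p = 2πξ`, in Fourier space. -/
def freeGroup (t : ℝ) : L2 →L[ℂ] L2 :=
  (Lp.fourierTransformₗᵢ ℝ ℂ).symm.toContinuousLinearEquiv.toContinuousLinearMap ∘L
    ((ContinuousLinearMap.mul ℂ ℂ).holderL volume ∞ 2 2 (memLp_freePhase t).toLp) ∘L
      (Lp.fourierTransformₗᵢ ℝ ℂ).toContinuousLinearEquiv.toContinuousLinearMap

/-- A linear operator in a Hilbert space is essentially self-adjoint on its domain if it is
closable with self-adjoint closure. -/
def IsEssentiallySelfAdjoint {E : Type*} [NormedAddCommGroup E] [InnerProductSpace ℂ E]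
    [CompleteSpace E] (A : E →ₗ.[ℂ] E) : Prop :=
  A.IsClosable ∧ IsSelfAdjoint A.closure

/-- `U` is the strongly continuous one-parameter unitary group `t ↦ e^{itA}`: its generator is
`iA`, that is, `ψ` is in the domain of `A` with `A ψ = χ` if and only if `t ↦ U t ψ` has the
derivative `i χ` at `t = 0`. -/
structure IsExpGroup {E : Type*} [NormedAddCommGroup E] [InnerProductSpace ℂ E]
    [CompleteSpace E] (A : E →ₗ.[ℂ] E) (U : ℝ → E →L[ℂ] E) : Prop where
  map_zero : U 0 = 1
  map_add : ∀ s t : ℝ, U (s + t) = U s ∘L U t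
  mem_unitary : ∀ t : ℝ, U t ∈ unitary (E →L[ℂ] E)
  continuous : ∀ ψ : E, Continuous fun t : ℝ => U t ψ
  mem_graph_iff : ∀ ψ χ : E,
    (ψ, χ) ∈ A.graph ↔ HasDerivAt (fun t : ℝ => U t ψ) (Complex.I • χ) 0

end SchrodingerPerturbation

end

/-! The time-averaged bound on `V` along the free flow is used twice: it controls `V` by `H₀`, and
it controls the difference of the two evolutions.

Let K be the norm of the bounded operator `C 1`. For Schwartz Φ, Ψ put f(s) = ⟨VΨ, e^{-isH₀}Φ⟩.
Integrating the derivative of (τ - s) f(s) over [0, τ] gives τ|f(0)| ≤ ∫|f| + τ∫|f'|. Since V is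
symmetric and 𝒟 is invariant under the free flow, Cauchy–Schwarz in time bounds the two integrals by
√τ K‖Ψ‖‖Φ‖ and √τ K‖Ψ‖‖H₀Φ‖ for τ ≤ 1. Hence ‖VΦ‖ ≤ K√τ‖H₀Φ‖ + (K/√τ)‖Φ‖ (`norm_potential_le`), so
the relative bound is as small as desired (`exists_relative_bound`). Essential self-adjointness is
then Kato–Rellich, proved by showing that H ± ir has dense range for large r
(`dense_range_perturbed`, `isEssentiallySelfAdjoint_of_dense_range`). The group e^{itH} comes from
Stone's theorem, proved with bounded commuting approximants (`existsUnique_isExpGroup`).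

For t ≥ 0, Duhamel's formula e^{itH}e^{-itH₀}Φ - Φ = i∫₀ᵗ e^{isH} V e^{-isH₀}Φ ds gives the bound
√t‖C_tΦ‖ (`norm_wave_sub_le`). By density it holds on all of L², and an operator dominated in this
way by a compact one is compact (`isCompactOperator_of_norm_le`). Negative times follow from the
group law.

The argument is carried out for an abstract `IsFreeEvolution`; the Fourier transform enters only in
checking that the free Schrödinger group is one. -/

noncomputable section

namespace SchrodingerPerturbation

/-! ### Calculus of strongly continuous unitary groups -/

section UnitaryGroup

variable {E : Type*} [NormedAddCommGroup E] [InnerProductSpace ℂ E] [CompleteSpace E]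

/-- A strongly continuous one-parameter unitary group. -/
structure IsUnitaryGroup (U : ℝ → E →L[ℂ] E) : Prop where
  map_zero : U 0 = 1
  map_add : ∀ s t : ℝ, U (s + t) = U s ∘L U t
  mem_unitary : ∀ t : ℝ, U t ∈ unitary (E →L[ℂ] E)
  continuous : ∀ ψ : E, Continuous fun t : ℝ => U t ψ

theorem IsExpGroup.isUnitaryGroup {A : E →ₗ.[ℂ] E} {U : ℝ → E →L[ℂ] E} (h : IsExpGroup A U) :
    IsUnitaryGroup U :=
  ⟨h.map_zero, h.map_add, h.mem_unitary, h.continuous⟩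

namespace IsUnitaryGroup

variable {U : ℝ → E →L[ℂ] E}

theorem inner_map_map (hU : IsUnitaryGroup U)
    (t : ℝ) (x y : E) : inner ℂ (U t x) (U t y) = inner ℂ x y := by
  have h := (Unitary.mem_iff.1 (hU.mem_unitary t)).1
  rw [← ContinuousLinearMap.adjoint_inner_left, ← ContinuousLinearMap.star_eq_adjoint,
    ← mul_apply_eq_comp, h, one_apply_eq_self]

theorem norm_map (hU : IsUnitaryGroup U) (t : ℝ) (x : E) : ‖U t x‖ = ‖x‖ := by
  rw [@norm_eq_sqrt_re_inner ℂ, @norm_eq_sqrt_re_inner ℂ, hU.inner_map_map]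

theorem map_add_apply (hU : IsUnitaryGroup U) (s t : ℝ) (x : E) : U (s + t) x = U s (U t x) := by
  rw [hU.map_add]; rfl

theorem map_neg_map (hU : IsUnitaryGroup U) (t : ℝ) (x : E) : U (-t) (U t x) = x := by
  rw [← hU.map_add_apply, neg_add_cancel, hU.map_zero]; rfl

theorem map_map_neg (hU : IsUnitaryGroup U) (t : ℝ) (x : E) : U t (U (-t) x) = x := by
  rw [← hU.map_add_apply, add_neg_cancel, hU.map_zero]; rfl

theorem map_comm (hU : IsUnitaryGroup U) (s t : ℝ) (x : E) : U s (U t x) = U t (U s x) := by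
  rw [← hU.map_add_apply, ← hU.map_add_apply, add_comm]

theorem inner_map_left (hU : IsUnitaryGroup U)
    (t : ℝ) (x y : E) : inner ℂ (U t x) y = inner ℂ x (U (-t) y) := by
  rw [← hU.inner_map_map (-t), hU.map_neg_map]

theorem hasDerivAt (hU : IsUnitaryGroup U) {ψ η : E} (h : HasDerivAt (fun t => U t ψ) η 0)
    (t : ℝ) :
    HasDerivAt (fun t => U t ψ) (U t η) t := by
  have h1 : HasDerivAt (fun s => U t (U s ψ)) (U t η) 0 := by
    exact ((U t).restrictScalars ℝ).hasFDerivAt.comp_hasDerivAt (0 : ℝ) h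
  have h2 : HasDerivAt (fun s => U t (U s ψ)) (U t η) (t - t) := by rwa [sub_self]
  have h3 := HasDerivAt.comp_sub_const t t h2
  refine h3.congr_of_eventuallyEq (Filter.Eventually.of_forall fun s => ?_)
  simp only
  rw [← hU.map_add_apply, add_sub_cancel]

theorem hasDerivAt_neg (hU : IsUnitaryGroup U)
    {ψ η : E} (h : HasDerivAt (fun t => U t ψ) η 0)
    (t : ℝ) :
    HasDerivAt (fun t => U (-t) ψ) (-U (-t) η) t := by
  have := (hU.hasDerivAt h (-t)).scomp t (_root_.hasDerivAt_neg t)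
  rwa [neg_one_smul] at this

/-- Strong continuity becomes joint continuity because every `U t` is an isometry. -/
theorem tendsto_apply (hU : IsUnitaryGroup U)
    {α : Type*} {l : Filter α} {f : α → ℝ} {g : α → E} {t : ℝ} {x : E}
    (hf : Filter.Tendsto f l (nhds t)) (hg : Filter.Tendsto g l (nhds x)) :
    Filter.Tendsto (fun a => U (f a) (g a)) l (nhds (U t x)) := by
  have h1 : Filter.Tendsto (fun a => U (f a) x) l (nhds (U t x)) :=
    ((hU.continuous x).tendsto t).comp hf
  have h2 : Filter.Tendsto (fun a => U (f a) (g a - x)) l (nhds 0) := by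
    rw [tendsto_zero_iff_norm_tendsto_zero]
    simp only [hU.norm_map]
    rw [← tendsto_zero_iff_norm_tendsto_zero]
    simpa using hg.sub_const x
  simpa using h1.add h2

theorem continuous_apply (hU : IsUnitaryGroup U)
    {α : Type*} [TopologicalSpace α] {f : α → ℝ} {g : α → E}
    (hf : Continuous f) (hg : Continuous g) : Continuous fun a => U (f a) (g a) :=
  continuous_iff_continuousAt.2 fun a =>
    hU.tendsto_apply (hf.tendsto a) (hg.tendsto a)

/-- A product rule for a group that need not be norm differentiable: the difference quotient splits
into `U s` applied to the slope of `φ`, which converges by joint continuity, and the slope of `U` on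
the fixed vector `φ t`. -/
theorem hasDerivAt_apply (hU : IsUnitaryGroup U)
    {φ : ℝ → E} {φ' η : E} {t : ℝ} (hφ : HasDerivAt φ φ' t)
    (h : HasDerivAt (fun s => U s (φ t)) η t) :
    HasDerivAt (fun s => U s (φ s)) (U t φ' + η) t := by
  rw [hasDerivAt_iff_tendsto_slope] at *
  have h1 : Filter.Tendsto (fun s : ℝ => U s (slope φ t s)) (nhdsWithin t {t}ᶜ)
      (nhds (U t φ')) :=
    hU.tendsto_apply (Filter.tendsto_id.mono_left nhdsWithin_le_nhds) hφ
  refine (h1.add h).congr fun s => ?_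
  simp only [slope_def_module]
  rw [← Complex.coe_smul, map_smul, Complex.coe_smul, map_sub, ← smul_add]
  congr 1
  abel

end IsUnitaryGroup

end UnitaryGroup

/-! ### Symmetric operators and the range criterion for essential self-adjointness -/

section Criterion

variable {E : Type*} [NormedAddCommGroup E] [InnerProductSpace ℂ E]

/-- The inner product of `x` and `y` is real, so the cross term is purely imaginary. With `y = A x`
and `A` symmetric, this bounds both `x` and `A x` by `(A + ir) x`. -/
theorem norm_add_I_smul_sq {x y : E} (h : inner ℂ y x = inner ℂ x y) (r : ℝ) :
    ‖y + (r * Complex.I) • x‖ ^ 2 = ‖y‖ ^ 2 + r ^ 2 * ‖x‖ ^ 2 := by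
  rw [@norm_add_sq ℂ, inner_smul_right, h, norm_smul]
  have him : (inner ℂ x y).im = 0 := by
    have h2 := inner_conj_symm (𝕜 := ℂ) x y
    rw [h] at h2
    exact Complex.conj_eq_iff_im.1 h2
  simp [him, mul_pow]

theorem inner_eq_of_mem_graph {A : E →ₗ.[ℂ] E} (hA : A.IsFormalAdjoint A) {x y x' y' : E}
    (h : (x, y) ∈ A.graph) (h' : (x', y') ∈ A.graph) : inner ℂ y x' = inner ℂ x y' := by
  rw [LinearPMap.mem_graph_iff] at h h'
  obtain ⟨a, rfl, rfl⟩ := h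
  obtain ⟨b, rfl, rfl⟩ := h'
  exact hA a b

variable [CompleteSpace E]

/-- The graph of the adjoint. -/
theorem mem_graph_adjoint_iff {A : E →ₗ.[ℂ] E} (hd : Dense (A.domain : Set E)) (x y : E) :
    (x, y) ∈ A.adjoint.graph ↔ ∀ a b, (a, b) ∈ A.graph → inner ℂ b x = inner ℂ a y := by
  rw [LinearPMap.adjoint_graph_eq_graph_adjoint hd, Submodule.mem_adjoint_iff]
  simp only [sub_eq_zero]

theorem mem_graph_of_isSelfAdjoint {A : E →ₗ.[ℂ] E} (hA : IsSelfAdjoint A) (x y : E)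
    (h : ∀ a b, (a, b) ∈ A.graph → inner ℂ b x = inner ℂ a y) : (x, y) ∈ A.graph := by
  rw [← mem_graph_adjoint_iff hA.dense_domain, LinearPMap.isSelfAdjoint_def.1 hA] at h
  exact h

theorem isFormalAdjoint_of_isSelfAdjoint {A : E →ₗ.[ℂ] E} (hA : IsSelfAdjoint A) :
    A.IsFormalAdjoint A := by
  have := LinearPMap.adjoint_isFormalAdjoint hA.dense_domain
  rwa [LinearPMap.isSelfAdjoint_def.1 hA] at this

/-- The range of `A + ir` is everything if it is dense and `A` is closed and symmetric. -/
theorem exists_mem_graph_add_of_dense {A : E →ₗ.[ℂ] E} (hs : A.IsFormalAdjoint A)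
    (hc : A.IsClosed) {r : ℝ} (hr : r ≠ 0)
    (hd : Dense {z : E | ∃ x y, (x, y) ∈ A.graph ∧ y + (r * Complex.I) • x = z}) (z : E) :
    ∃ x y, (x, y) ∈ A.graph ∧ y + (r * Complex.I) • x = z := by
  have hz : z ∈ closure {z : E | ∃ x y, (x, y) ∈ A.graph ∧ y + (r * Complex.I) • x = z} := hd z
  obtain ⟨u, hu, hlim⟩ := mem_closure_iff_seq_limit.1 hz
  choose x y hxy hu using hu
  have hcau : CauchySeq u := hlim.cauchySeq
  -- This identity transfers the Cauchy property from `u` to `y`, and then to `x` since `r ≠ 0`;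
  -- closedness of the graph does the rest.
  have key : ∀ m n, ‖u m - u n‖ ^ 2 = ‖y m - y n‖ ^ 2 + r ^ 2 * ‖x m - x n‖ ^ 2 := by
    intro m n
    have hmem : (x m - x n, y m - y n) ∈ A.graph := A.graph.sub_mem (hxy m) (hxy n)
    rw [← norm_add_I_smul_sq (inner_eq_of_mem_graph hs hmem hmem), ← hu m, ← hu n, smul_sub]
    congr 2
    abel
  have hy : CauchySeq y := by
    refine Metric.cauchySeq_iff.2 fun ε hε => ?_
    obtain ⟨N, hN⟩ := Metric.cauchySeq_iff.1 hcau ε hε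
    refine ⟨N, fun m hm n hn => lt_of_le_of_lt ?_ (hN m hm n hn)⟩
    rw [dist_eq_norm, dist_eq_norm]
    refine le_of_sq_le_sq ?_ (norm_nonneg _)
    rw [key]
    exact le_add_of_nonneg_right (by positivity)
  have hx : CauchySeq x := by
    have h1 : ∀ n, x n = ((r : ℂ) * Complex.I)⁻¹ • (u n - y n) := by
      intro n
      rw [← hu n, add_sub_cancel_left, smul_smul, inv_mul_cancel₀, one_smul]
      simpa using hr
    have h2 : CauchySeq (fun n => u n - y n) :=
      uniformContinuous_sub.comp_cauchySeq (hcau.prodMk hy)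
    have h3 := (uniformContinuous_const_smul ((r : ℂ) * Complex.I)⁻¹).comp_cauchySeq h2
    rw [show x = _ from funext h1]
    exact h3
  obtain ⟨x₀, hx₀⟩ := cauchySeq_tendsto_of_complete hx
  obtain ⟨y₀, hy₀⟩ := cauchySeq_tendsto_of_complete hy
  refine ⟨x₀, y₀, ?_, ?_⟩
  · exact hc.mem_of_tendsto (hx₀.prodMk_nhds hy₀) (Filter.Eventually.of_forall hxy)
  · refine tendsto_nhds_unique ?_ hlim
    rw [show u = fun n => y n + (r * Complex.I) • x n from funext fun n => (hu n).symm]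
    exact hy₀.add (hx₀.const_smul _)

/-- A densely defined symmetric operator `A` such that `A + ir` and `A - ir` have dense range is
essentially self-adjoint. -/
theorem isEssentiallySelfAdjoint_of_dense_range {A : E →ₗ.[ℂ] E} (hs : A.IsFormalAdjoint A)
    (hdom : Dense (A.domain : Set E)) {r : ℝ} (hr : r ≠ 0)
    (h₁ : Dense {z : E | ∃ x y, (x, y) ∈ A.graph ∧ y + (r * Complex.I) • x = z})
    (h₂ : Dense {z : E | ∃ x y, (x, y) ∈ A.graph ∧ y + ((-r : ℝ) * Complex.I) • x = z}) :
    IsEssentiallySelfAdjoint A := by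
  have hle : A ≤ A.adjoint := LinearPMap.IsFormalAdjoint.le_adjoint hdom hs
  have hcl : A.IsClosable :=
    (LinearPMap.adjoint_isClosed hdom).isClosable.leIsClosable hle
  refine ⟨hcl, ?_⟩
  have hcle : A.closure ≤ A.adjoint := by
    have h := (LinearPMap.adjoint_isClosed hdom).isClosable.closure_mono hle
    refine h.trans (LinearPMap.le_of_le_graph ?_)
    rw [← (LinearPMap.adjoint_isClosed hdom).isClosable.graph_closure_eq_closure_graph,
      (LinearPMap.adjoint_isClosed hdom).submodule_topologicalClosure_eq]
  have hgle : A.graph ≤ A.closure.graph := LinearPMap.le_graph_of_le A.le_closure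
  have hcd : Dense (A.closure.domain : Set E) := hdom.mono A.le_closure.1
  have hcs : A.closure.IsFormalAdjoint A.closure := by
    intro x y
    have hx := LinearPMap.le_graph_of_le hcle (A.closure.mem_graph x)
    have hy : ((y : E), A.closure y) ∈ (A.graph.topologicalClosure) := by
      rw [hcl.graph_closure_eq_closure_graph]
      exact A.closure.mem_graph y
    have hclosed : IsClosed {p : E × E | inner ℂ (A.closure x) p.1 = inner ℂ (x : E) p.2} :=
      isClosed_eq (by fun_prop) (by fun_prop)
    refine (closure_minimal ?_ hclosed) hy
    rintro ⟨a, b⟩ hab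
    have := (mem_graph_adjoint_iff hdom _ _).1 hx a b hab
    simp only [Set.mem_ofPred_eq]
    rw [← inner_conj_symm, ← this, inner_conj_symm]
  rw [LinearPMap.isSelfAdjoint_def]
  refine le_antisymm ?_ (LinearPMap.IsFormalAdjoint.le_adjoint hcd hcs)
  refine LinearPMap.le_of_le_graph ?_
  rintro ⟨ψ, χ⟩ hψ
  rw [mem_graph_adjoint_iff hcd] at hψ
  -- For `ψ` in the domain of the adjoint, `φ` solves `(Ā + ir) φ = (A* + ir) ψ`. Then `ψ - φ` lies
  -- in the kernel of `A* + ir`, hence is orthogonal to the dense range of `A - ir`, so `ψ = φ` is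
  -- in the domain of the closure.
  obtain ⟨φ, η, hφ, heq⟩ := exists_mem_graph_add_of_dense hcs hcl.closure_isClosed hr
    (h₁.mono (by rintro z ⟨x, y, hxy, rfl⟩; exact ⟨x, y, hgle hxy, rfl⟩)) (χ + (r * Complex.I) • ψ)
  have hzero : ψ - φ = 0 := by
    refine h₂.eq_zero_of_inner_right ℂ ?_
    rintro _ ⟨a, b, hab, rfl⟩
    have e1 := hψ a b (hgle hab)
    have e2 := inner_eq_of_mem_graph hcs (hgle hab) hφ
    have e3 : η = χ + (r * Complex.I) • (ψ - φ) := by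
      rw [smul_sub, ← add_sub_assoc, ← heq, add_sub_cancel_right]
    rw [e3] at e2
    rw [inner_add_left, inner_sub_right, e1, e2, inner_add_right, inner_smul_left,
      inner_smul_right]
    simp
  have hφψ : ψ = φ := sub_eq_zero.1 hzero
  subst hφψ
  have : η = χ := add_right_cancel heq
  rwa [← this]

end Criterion

/-! ### Exponentials of bounded self-adjoint operators -/

section BoundedGenerator

variable {E : Type*} [NormedAddCommGroup E] [InnerProductSpace ℂ E] [CompleteSpace E]

/-- The unitary group `exp(itB)` of a bounded operator `B`. -/
def boundedExp (B : E →L[ℂ] E) (t : ℝ) : E →L[ℂ] E :=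
  NormedSpace.exp (t • (Complex.I • B))

theorem hasDerivAt_boundedExp (B : E →L[ℂ] E) (t : ℝ) :
    HasDerivAt (boundedExp B) (boundedExp B t * (Complex.I • B)) t :=
  hasDerivAt_exp_smul_const (𝕂 := ℝ) (Complex.I • B) t

theorem hasDerivAt_boundedExp_apply (B : E →L[ℂ] E) (ψ : E) (t : ℝ) :
    HasDerivAt (fun s => boundedExp B s ψ) (boundedExp B t (Complex.I • B ψ)) t := by
  have h := (ContinuousLinearMap.apply ℝ E ψ ∘L
    (ContinuousLinearMap.restrictScalarsL ℂ E E ℝ ℝ)).hasFDerivAt.comp_hasDerivAt t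
      (hasDerivAt_boundedExp B t)
  exact h

theorem isUnitaryGroup_boundedExp {B : E →L[ℂ] E} (hB : IsSelfAdjoint B) :
    IsUnitaryGroup (boundedExp B) := by
  have h0 : boundedExp B 0 = 1 := by simp [boundedExp]
  have hadd : ∀ s t, boundedExp B (s + t) = boundedExp B s * boundedExp B t := by
    intro s t
    let : NormedAlgebra ℚ (E →L[ℂ] E) := NormedAlgebra.restrictScalars ℚ ℂ _
    rw [boundedExp, add_smul, NormedSpace.exp_add_of_commute]
    · rfl
    · exact ((Commute.refl _).smul_left _).smul_right _
  refine ⟨h0, hadd, fun t => ?_, fun ψ => ?_⟩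
  · have hstar : star (boundedExp B t) = boundedExp B (-t) := by
      rw [boundedExp, NormedSpace.star_exp, star_smul, star_smul, hB.star_eq, boundedExp]
      simp
    rw [Unitary.mem_iff, hstar, ← hadd, ← hadd]
    simp [h0]
  · exact continuous_iff_continuousAt.2 fun t => (hasDerivAt_boundedExp_apply B ψ t).continuousAt

theorem boundedExp_apply_comm {B B' : E →L[ℂ] E} (h : Commute B B') (t : ℝ) (ψ : E) :
    B' (boundedExp B t ψ) = boundedExp B t (B' ψ) := by
  have h1 : Commute B' (boundedExp B t) :=
    Commute.exp_right ((h.symm.smul_right _).smul_right _)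
  exact DFunLike.congr_fun h1.eq ψ

/-- Since `B` and `B'` commute, the derivative of `e^{-isB'} e^{isB} ψ` is a unitary operator
applied to `i (B - B') ψ`, of constant norm; the mean value inequality concludes. Only the values at
`ψ` enter, so strong convergence of generators suffices later. -/
theorem norm_boundedExp_sub_le {B B' : E →L[ℂ] E} (hB : IsSelfAdjoint B) (hB' : IsSelfAdjoint B')
    (h : Commute B B') (t : ℝ) (ψ : E) :
    ‖boundedExp B t ψ - boundedExp B' t ψ‖ ≤ ‖B ψ - B' ψ‖ * |t| := by
  have hU := isUnitaryGroup_boundedExp hB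
  have hU' := isUnitaryGroup_boundedExp hB'
  have hV : IsUnitaryGroup fun s => boundedExp B' (-s) := by
    refine ⟨by simp [hU'.map_zero], fun s t => ?_, fun t => hU'.mem_unitary _, fun ψ =>
      (hU'.continuous ψ).comp continuous_neg⟩
    rw [neg_add, hU'.map_add]
  have hder : ∀ s : ℝ, HasDerivAt (fun s => boundedExp B' (-s) (boundedExp B s ψ))
      (boundedExp B' (-s) (boundedExp B s (Complex.I • (B ψ - B' ψ)))) s := by
    intro s
    have h1 := hV.hasDerivAt_apply (hasDerivAt_boundedExp_apply B ψ s)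
      (hU'.hasDerivAt_neg (η := Complex.I • B' (boundedExp B s ψ)) (by
        have := hasDerivAt_boundedExp_apply B' (boundedExp B s ψ) 0
        rwa [hU'.map_zero] at this) s)
    convert h1 using 1
    rw [boundedExp_apply_comm h, smul_sub, map_sub, map_sub, ← sub_eq_add_neg]
    simp only [map_smul]
  have := Convex.norm_image_sub_le_of_norm_hasDerivWithin_le (C := ‖B ψ - B' ψ‖)
    (fun s _ => (hder s).hasDerivWithinAt) (fun s _ => by
      rw [hU'.norm_map, hU.norm_map, norm_smul, Complex.norm_I, one_mul]) convex_univ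
      (Set.mem_univ (0 : ℝ)) (Set.mem_univ t)
  simp only [sub_zero, Real.norm_eq_abs, neg_zero, hU'.map_zero, hU.map_zero,
    one_apply_eq_self] at this
  refine le_trans (le_of_eq ?_) this
  rw [← hU'.norm_map (-t), map_sub, hU'.map_neg_map]

end BoundedGenerator

/-! ### Strong limits of contractions tested on a dense set -/

section Dense

variable {E F : Type*} [NormedAddCommGroup E] [NormedSpace ℂ E] [NormedAddCommGroup F]
  [NormedSpace ℂ F]

theorem cauchySeq_apply_of_dense {T : ℕ → E →L[ℂ] F} (hT : ∀ n x, ‖T n x‖ ≤ ‖x‖) {s : Set E}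
    (hs : Dense s) (h : ∀ x ∈ s, CauchySeq fun n => T n x) (x : E) : CauchySeq fun n => T n x := by
  refine Metric.cauchySeq_iff.2 fun ε hε => ?_
  obtain ⟨y, hys, hy⟩ := hs.exists_dist_lt x (show 0 < ε / 3 by positivity)
  obtain ⟨N, hN⟩ := Metric.cauchySeq_iff.1 (h y hys) (ε / 3) (by positivity)
  refine ⟨N, fun m hm n hn => ?_⟩
  have h1 := hN m hm n hn
  rw [dist_eq_norm] at *
  have e : T m x - T n x = (T m y - T n y) + T m (x - y) - T n (x - y) := by
    simp only [map_sub]; abel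
  rw [e]
  have h2 := (norm_sub_le ((T m y - T n y) + T m (x - y)) (T n (x - y)))
  have h3 := norm_add_le (T m y - T n y) (T m (x - y))
  have h4 := hT m (x - y)
  have h5 := hT n (x - y)
  linarith

theorem tendsto_apply_of_dense {T : ℕ → E →L[ℂ] F} (hT : ∀ n x, ‖T n x‖ ≤ ‖x‖) {T₀ : E →L[ℂ] F}
    (hT₀ : ∀ x, ‖T₀ x‖ ≤ ‖x‖) {s : Set E} (hs : Dense s)
    (h : ∀ x ∈ s, Filter.Tendsto (fun n => T n x) Filter.atTop (nhds (T₀ x))) (x : E) :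
    Filter.Tendsto (fun n => T n x) Filter.atTop (nhds (T₀ x)) := by
  refine Metric.tendsto_atTop.2 fun ε hε => ?_
  obtain ⟨y, hys, hy⟩ := hs.exists_dist_lt x (show 0 < ε / 3 by positivity)
  obtain ⟨N, hN⟩ := Metric.tendsto_atTop.1 (h y hys) (ε / 3) (by positivity)
  refine ⟨N, fun n hn => ?_⟩
  have h1 := hN n hn
  rw [dist_eq_norm] at *
  have e : T n x - T₀ x = (T n y - T₀ y) + T n (x - y) - T₀ (x - y) := by
    simp only [map_sub]; abel
  rw [e]
  have h2 := (norm_sub_le ((T n y - T₀ y) + T n (x - y)) (T₀ (x - y)))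
  have h3 := norm_add_le (T n y - T₀ y) (T n (x - y))
  have h4 := hT n (x - y)
  have h5 := hT₀ (x - y)
  linarith

end Dense

/-! ### Resolvents and bounded approximations of a self-adjoint operator -/

section Resolvent

variable {E : Type*} [NormedAddCommGroup E] [InnerProductSpace ℂ E]
  {A : E →ₗ.[ℂ] E}

theorem eq_zero_of_mem_graph (hs : A.IsFormalAdjoint A) {r : ℝ} (hr : r ≠ 0) {x y : E}
    (h : (x, y) ∈ A.graph) (h0 : y + (r * Complex.I) • x = 0) : x = 0 := by
  have := norm_add_I_smul_sq (inner_eq_of_mem_graph hs h h) r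
  rw [h0, norm_zero] at this
  have h1 : r ^ 2 * ‖x‖ ^ 2 = 0 := by
    nlinarith [sq_nonneg ‖y‖, mul_nonneg (sq_nonneg r) (sq_nonneg ‖x‖)]
  simpa [hr] using h1

/-- `R` is the resolvent `(A + ir)⁻¹`. -/
structure IsResolvent (A : E →ₗ.[ℂ] E) (r : ℝ) (R : E →L[ℂ] E) : Prop where
  mem_graph : ∀ z, (R z, z - (r * Complex.I) • R z) ∈ A.graph
  norm_le : ∀ z, ‖((r * Complex.I) • R) z‖ ≤ ‖z‖
  apply_add : ∀ x y, (x, y) ∈ A.graph → R (y + (r * Complex.I) • x) = x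

/-- For `r ≠ s` the resolvent identity, written with either factor first, expresses the same
difference through `S R` and through `R S`. -/
theorem IsResolvent.commute {r s : ℝ} {R S : E →L[ℂ] E} (h : IsResolvent A r R)
    (h' : IsResolvent A s S) : Commute R S := by
  by_cases hrs : r = s
  · subst hrs
    have : R = S := by
      ext z
      have := h'.apply_add _ _ (h.mem_graph z)
      rw [sub_add_cancel] at this
      exact this.symm
    rw [this]
  · have e1 : ∀ z, R z - S z = (((s : ℂ) - r) * Complex.I) • S (R z) := by
      intro z
      have := h'.apply_add _ _ (h.mem_graph z)
      have e : z - ((r : ℂ) * Complex.I) • R z + ((s : ℂ) * Complex.I) • R z =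
          z + (((s : ℂ) - r) * Complex.I) • R z := by
        module
      rw [e, map_add, map_smul] at this
      rw [sub_eq_iff_eq_add, add_comm, this]
    have e2 : ∀ z, S z - R z = (((r : ℂ) - s) * Complex.I) • R (S z) := by
      intro z
      have := h.apply_add _ _ (h'.mem_graph z)
      have e : z - ((s : ℂ) * Complex.I) • S z + ((r : ℂ) * Complex.I) • S z =
          z + (((r : ℂ) - s) * Complex.I) • S z := by
        module
      rw [e, map_add, map_smul] at this
      rw [sub_eq_iff_eq_add, add_comm, this]
    ext z
    have hne : (((s : ℂ) - r) * Complex.I) ≠ 0 :=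
      mul_ne_zero (sub_ne_zero.2 (by exact_mod_cast Ne.symm hrs)) Complex.I_ne_zero
    refine smul_right_injective E hne ?_
    have h2 := e2 z
    rw [← neg_sub, e1 z, ← neg_sub (s : ℂ), neg_mul, neg_smul, neg_inj] at h2
    exact h2.symm

variable [CompleteSpace E]

theorem exists_isResolvent (hA : IsSelfAdjoint A) {r : ℝ} (hr : r ≠ 0) :
    ∃ R : E →L[ℂ] E, IsResolvent A r R := by
  have hs := isFormalAdjoint_of_isSelfAdjoint hA
  have hsurj : ∀ z : E, ∃ x y, (x, y) ∈ A.graph ∧ y + (r * Complex.I) • x = z := by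
    refine exists_mem_graph_add_of_dense hs hA.isClosed hr ?_
    have hdense : Dense ((LinearMap.range (A.toFun + (r * Complex.I) • A.domain.subtype) :
        Submodule ℂ E) : Set E) := by
      rw [Submodule.dense_iff_topologicalClosure_eq_top,
        Submodule.topologicalClosure_eq_top_iff, Submodule.eq_bot_iff]
      intro χ hχ
      rw [Submodule.mem_orthogonal] at hχ
      -- A vector orthogonal to the range of `A + ir` lies in the kernel of `A* - ir = A - ir`,
      -- which is trivial by symmetry.
      have hg : (χ, ((r : ℂ) * Complex.I) • χ) ∈ A.graph := by
        refine mem_graph_of_isSelfAdjoint hA _ _ fun a b hab => ?_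
        rw [LinearPMap.mem_graph_iff] at hab
        obtain ⟨a, rfl, rfl⟩ := hab
        have := hχ _ ⟨a, rfl⟩
        simp only [LinearMap.add_apply, LinearMap.smul_apply, Submodule.subtype_apply,
          inner_add_left, inner_smul_left] at this
        rw [inner_smul_right]
        have h2 : inner ℂ (A a) χ = - ((starRingEnd ℂ) (r * Complex.I) * inner ℂ (a : E) χ) :=
          eq_neg_of_add_eq_zero_left this
        rw [h2]
        simp
      refine eq_zero_of_mem_graph hs (neg_ne_zero.2 hr) hg ?_
      rw [← add_smul]; simp
    refine hdense.mono ?_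
    rintro _ ⟨x, rfl⟩
    exact ⟨x, A x, A.mem_graph x, rfl⟩
  choose x y hxy hz using hsurj
  have huniq : ∀ a b z, (a, b) ∈ A.graph → b + (r * Complex.I) • a = z → x z = a := by
    intro a b z hab h
    rw [← sub_eq_zero]
    refine eq_zero_of_mem_graph hs hr (A.graph.sub_mem (hxy z) hab) ?_
    have : y z - b + ((r : ℂ) * Complex.I) • (x z - a) =
        (y z + ((r : ℂ) * Complex.I) • x z) - (b + (r * Complex.I) • a) := by
      rw [smul_sub]; abel
    rw [this, hz, h, sub_self]
  have hnorm : ∀ z, |r| * ‖x z‖ ≤ ‖z‖ := by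
    intro z
    refine le_of_sq_le_sq ?_ (norm_nonneg _)
    have := norm_add_I_smul_sq (inner_eq_of_mem_graph hs (hxy z) (hxy z)) r
    rw [hz] at this
    rw [this, mul_pow, sq_abs]
    exact le_add_of_nonneg_left (by positivity)
  let R₀ : E →ₗ[ℂ] E :=
    { toFun := x
      map_add' := fun z w => by
        refine huniq _ (y z + y w) _ (A.graph.add_mem (hxy z) (hxy w)) ?_
        conv_rhs => rw [← hz z, ← hz w]
        rw [smul_add]; abel
      map_smul' := fun c z => by
        refine huniq _ (c • y z) _ (A.graph.smul_mem c (hxy z)) ?_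
        conv_rhs => rw [← hz z]
        rw [RingHom.id_apply, smul_add, smul_comm] }
  let R : E →L[ℂ] E := R₀.mkContinuous |r|⁻¹ fun z => by
    rw [inv_mul_eq_div, le_div_iff₀ (abs_pos.2 hr), mul_comm]
    exact hnorm z
  refine ⟨R, fun z => ?_, fun z => ?_, fun a b hab => huniq a b _ hab rfl⟩
  · have : z - ((r : ℂ) * Complex.I) • R z = y z := by
      exact sub_eq_iff_eq_add.2 (hz z).symm
    rw [this]
    exact hxy z
  · rw [smul_apply, norm_smul]
    rw [norm_mul, Complex.norm_I, mul_one, Complex.norm_real]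
    exact hnorm z

namespace IsResolvent

theorem inner_apply (hA : IsSelfAdjoint A) {r : ℝ} {R R' : E →L[ℂ] E} (h : IsResolvent A r R)
    (h' : IsResolvent A (-r) R') (z w : E) : inner ℂ (R z) w = inner ℂ z (R' w) := by
  have := inner_eq_of_mem_graph (isFormalAdjoint_of_isSelfAdjoint hA)
    (h.mem_graph z) (h'.mem_graph w)
  rw [inner_sub_left, inner_sub_right, inner_smul_left, inner_smul_right] at this
  simp at this
  exact this.symm

/-- On the domain, `ir R x - x = -R (A x)` has norm at most `‖A x‖ / |r|`; the uniform bound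
`norm_le` extends the convergence to all vectors. -/
theorem tendsto (hA : IsSelfAdjoint A) {r : ℕ → ℝ}
    (hr : Filter.Tendsto (fun n => |r n|) Filter.atTop Filter.atTop) {R : ℕ → E →L[ℂ] E}
    (h : ∀ n, IsResolvent A (r n) (R n)) (ψ : E) :
    Filter.Tendsto (fun n => ((r n * Complex.I) • R n) ψ) Filter.atTop (nhds ψ) := by
  refine tendsto_apply_of_dense (T₀ := ContinuousLinearMap.id ℂ E) (fun n => (h n).norm_le)
    (fun x => le_rfl) hA.dense_domain (fun x hx => ?_) ψ
  have hx' := A.mem_graph ⟨x, hx⟩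
  set y := A ⟨x, hx⟩
  rw [tendsto_iff_norm_sub_tendsto_zero]
  have hlim : Filter.Tendsto (fun n => ‖y‖ * |r n|⁻¹) Filter.atTop (nhds 0) := by
    simpa using hr.inv_tendsto_atTop.const_mul ‖y‖
  refine squeeze_zero' (Filter.Eventually.of_forall fun n => norm_nonneg _) ?_ hlim
  filter_upwards [hr.eventually_gt_atTop 0] with n hn
  have e : ((r n * Complex.I) • R n) x - x = - R n y := by
    have : R n (y + (r n * Complex.I) • x) = x := (h n).apply_add _ _ hx'
    rw [map_add, map_smul] at this
    rw [smul_apply]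
    nth_rewrite 2 [← this]
    abel
  have hle := (h n).norm_le y
  rw [smul_apply, norm_smul, norm_mul, Complex.norm_I, mul_one,
    Complex.norm_real, Real.norm_eq_abs] at hle
  rw [ContinuousLinearMap.id_apply, e, norm_neg, ← div_eq_mul_inv, le_div_iff₀ hn, mul_comm]
  exact hle

end IsResolvent

/-- The Yosida approximation of a self-adjoint operator. -/
theorem exists_bounded_approx (hA : IsSelfAdjoint A) :
    ∃ B : ℕ → E →L[ℂ] E, (∀ n, IsSelfAdjoint (B n)) ∧ (∀ m n, Commute (B m) (B n)) ∧
      ∀ x y, (x, y) ∈ A.graph → Filter.Tendsto (fun n => B n x) Filter.atTop (nhds y) := by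
  have hpos : ∀ n : ℕ, ((n : ℝ) + 1) ≠ 0 := fun n => by positivity
  have hneg : ∀ n : ℕ, (-((n : ℝ) + 1)) ≠ 0 := fun n => neg_ne_zero.2 (hpos n)
  choose R hR using fun n : ℕ => exists_isResolvent hA (hpos n)
  choose R' hR' using fun n : ℕ => exists_isResolvent hA (hneg n)
  have hadj : ∀ n, star (R n) = R' n := by
    intro n
    rw [ContinuousLinearMap.star_eq_adjoint]
    refine ((ContinuousLinearMap.eq_adjoint_iff _ _).2 fun x y => ?_).symm
    rw [← inner_conj_symm, ← IsResolvent.inner_apply hA (hR n) (hR' n), inner_conj_symm]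
  have hadj' : ∀ n, star (R' n) = R n := fun n => by rw [← hadj, star_star]
  -- With `λ = n + 1`, the approximant is `(λ²/2)((A + iλ)⁻¹ + (A - iλ)⁻¹)`, formally `λ² A / (A² +
  -- λ²)`. The symmetric combination makes it self-adjoint, the two resolvents being mutually
  -- adjoint.
  let c : ℕ → ℝ := fun n => ((n : ℝ) + 1) ^ 2 / 2
  refine ⟨fun n => c n • (R n + R' n), fun n => ?_, fun m n => ?_, fun x y hxy => ?_⟩
  · rw [isSelfAdjoint_iff, star_smul, star_add, hadj, hadj', add_comm, star_trivial]
  · refine Commute.smul_left (Commute.smul_right ?_ _) _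
    exact (((hR m).commute (hR n)).add_right ((hR m).commute (hR' n))).add_left
      (((hR' m).commute (hR n)).add_right ((hR' m).commute (hR' n)))
  · have habs : Filter.Tendsto (fun n : ℕ => |(n : ℝ) + 1|) Filter.atTop Filter.atTop :=
      Filter.tendsto_abs_atTop_atTop.comp
        (Filter.tendsto_atTop_add_const_right _ _ tendsto_natCast_atTop_atTop)
    have h1 := IsResolvent.tendsto hA habs hR y
    have h2 := IsResolvent.tendsto hA (r := fun n : ℕ => -((n : ℝ) + 1))
      (by simpa only [abs_neg]) hR' y
    have h3 := (h1.add h2).const_smul (1 / 2 : ℂ)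
    have e : (1 / 2 : ℂ) • (y + y) = y := by module
    rw [e] at h3
    -- On the domain, `x = R (y + iλx)` and `x = R' (y - iλx)`; the terms in `x` cancel in the sum,
    -- leaving the average of `iλR y` and `-iλR' y`.
    refine h3.congr fun n => ?_
    have hn : ((n : ℂ) + 1) ≠ 0 := by exact_mod_cast Nat.succ_ne_zero n
    have e1 := (hR n).apply_add x y hxy
    have e2 := (hR' n).apply_add x y hxy
    rw [map_add, map_smul, ← eq_sub_iff_add_eq] at e1 e2
    simp only [smul_apply, add_apply, e1, e2, c]
    push_cast
    rw [← Complex.coe_smul]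
    push_cast
    have hI : Complex.I * Complex.I = -1 := Complex.I_mul_I
    match_scalars <;> ring_nf <;> simp <;> ring

end Resolvent

/-- A group of isometries is strongly continuous if it is so at `0` on a dense set. -/
theorem continuous_of_dense {E : Type*} [NormedAddCommGroup E] [NormedSpace ℂ E]
    {U : ℝ → E →L[ℂ] E} (hUadd : ∀ s t, U (s + t) = U s ∘L U t)
    (hUn : ∀ t x, ‖U t x‖ = ‖x‖) {D : Set E} (hD : Dense D)
    (h : ∀ x ∈ D, Filter.Tendsto (fun t => U t x) (nhds 0) (nhds x)) (x : E) :
    Continuous fun t => U t x := by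
  have hcont0 : Filter.Tendsto (fun t => U t x) (nhds 0) (nhds x) := by
    refine Metric.tendsto_nhds.2 fun ε hε => ?_
    obtain ⟨y, hyD, hy⟩ := hD.exists_dist_lt x (show 0 < ε / 3 by positivity)
    filter_upwards [Metric.tendsto_nhds.1 (h y hyD) (ε / 3) (by positivity)] with t ht
    rw [dist_eq_norm] at *
    have e : U t x - x = U t (x - y) + (U t y - y) - (x - y) := by rw [map_sub]; abel
    rw [e]
    have h1 := norm_sub_le (U t (x - y) + (U t y - y)) (x - y)
    have h2 := norm_add_le (U t (x - y)) (U t y - y)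
    have h3 := hUn t (x - y)
    linarith
  refine continuous_iff_continuousAt.2 fun t => ?_
  have h1 : Filter.Tendsto (fun s => U t (U (s - t) x)) (nhds t) (nhds (U t x)) := by
    refine ((U t).continuous.tendsto x).comp (hcont0.comp ?_)
    have : Continuous fun s : ℝ => s - t := by fun_prop
    simpa using this.tendsto t
  refine h1.congr fun s => ?_
  rw [← ContinuousLinearMap.comp_apply, ← hUadd, add_sub_cancel]

/-! ### Stone's theorem: existence and uniqueness of the group -/

section Stone

variable {E : Type*} [NormedAddCommGroup E] [InnerProductSpace ℂ E] [CompleteSpace E]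
  {A : E →ₗ.[ℂ] E}

/-- Differentiate the constant function `⟨U t a, U t x⟩` at `0`. -/
theorem IsUnitaryGroup.inner_hasDerivAt_symm {U : ℝ → E →L[ℂ] E} (hU : IsUnitaryGroup U)
    {a b x y : E} (ha : HasDerivAt (fun t => U t a) (Complex.I • b) 0)
    (hx : HasDerivAt (fun t => U t x) (Complex.I • y) 0) : inner ℂ b x = inner ℂ a y := by
  have h1 : HasDerivAt (fun t => inner ℂ (U t a) (U t x))
      (inner ℂ (U 0 a) (Complex.I • y) + inner ℂ (Complex.I • b) (U 0 x)) 0 := ha.inner ℂ hx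
  simp only [hU.inner_map_map, hU.map_zero, one_apply_eq_self] at h1
  have h2 := h1.unique (hasDerivAt_const 0 (inner ℂ a x))
  rw [inner_smul_left, inner_smul_right, Complex.conj_I] at h2
  have h3 : Complex.I * (inner ℂ a y - inner ℂ b x) = 0 := by rw [← h2]; ring
  rcases mul_eq_zero.1 h3 with h | h
  · exact absurd h Complex.I_ne_zero
  · exact (sub_eq_zero.1 h).symm

/-- The exponentials are Cauchy on `D` by `norm_boundedExp_sub_le`, hence everywhere, being
isometries. Only the values of `T` on `D` matter. -/
theorem exists_isUnitaryGroup_of_approx {B : ℕ → E →L[ℂ] E} (hB : ∀ n, IsSelfAdjoint (B n))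
    (hcomm : ∀ m n, Commute (B m) (B n)) {D : Set E} (hD : Dense D) {T : E → E}
    (hlim : ∀ x ∈ D, Filter.Tendsto (fun n => B n x) Filter.atTop (nhds (T x))) :
    ∃ U : ℝ → E →L[ℂ] E, IsUnitaryGroup U ∧
      ∀ x ∈ D, HasDerivAt (fun t => U t x) (Complex.I • T x) 0 := by
  have hG := fun n => isUnitaryGroup_boundedExp (hB n)
  have hcau : ∀ t x, CauchySeq fun n => boundedExp (B n) t x := by
    intro t x
    refine cauchySeq_apply_of_dense (fun n x => ((hG n).norm_map t x).le) hD (fun x hx => ?_) x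
    have hc := (hlim x hx).cauchySeq
    refine Metric.cauchySeq_iff.2 fun ε hε => ?_
    obtain ⟨N, hN⟩ := Metric.cauchySeq_iff.1 hc (ε / (|t| + 1)) (by positivity)
    refine ⟨N, fun m hm n hn => ?_⟩
    have h1 := hN m hm n hn
    rw [dist_eq_norm] at *
    refine lt_of_le_of_lt (norm_boundedExp_sub_le (hB m) (hB n) (hcomm m n) t x) ?_
    rw [lt_div_iff₀ (by positivity)] at h1
    nlinarith [norm_nonneg (B m x - B n x), abs_nonneg t]
  choose L hL using fun t x => cauchySeq_tendsto_of_complete (hcau t x)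
  have hnorm : ∀ t x, ‖L t x‖ = ‖x‖ := fun t x =>
    tendsto_nhds_unique (hL t x).norm (by simp only [(hG _).norm_map]; exact tendsto_const_nhds)
  let U : ℝ → E →L[ℂ] E := fun t => LinearMap.mkContinuous
    { toFun := L t
      map_add' := fun x y => tendsto_nhds_unique (hL t (x + y)) (by
        simp only [map_add]; exact (hL t x).add (hL t y))
      map_smul' := fun c x => tendsto_nhds_unique (hL t (c • x)) (by
        simp only [map_smul]; exact (hL t x).const_smul c) } 1 fun x => by
      rw [one_mul]; exact (hnorm t x).le
  have hU : ∀ t x, Filter.Tendsto (fun n => boundedExp (B n) t x) Filter.atTop (nhds (U t x)) := hL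
  have hUn : ∀ t x, ‖U t x‖ = ‖x‖ := hnorm
  have hU0 : U 0 = 1 := by
    ext x
    refine tendsto_nhds_unique (hU 0 x) ?_
    simp only [(hG _).map_zero]
    exact tendsto_const_nhds
  have hUadd : ∀ s t, U (s + t) = U s ∘L U t := by
    intro s t
    ext x
    refine tendsto_nhds_unique (hU (s + t) x) ?_
    have h1 : Filter.Tendsto (fun n => boundedExp (B n) s (boundedExp (B n) t x - U t x))
        Filter.atTop (nhds 0) := by
      rw [tendsto_zero_iff_norm_tendsto_zero]
      simp only [(hG _).norm_map]
      rw [← tendsto_zero_iff_norm_tendsto_zero]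
      simpa using (hU t x).sub_const (U t x)
    have h2 := h1.add (hU s (U t x))
    simp only [map_sub, sub_add_cancel, zero_add] at h2
    simpa only [(hG _).map_add_apply, ContinuousLinearMap.comp_apply] using h2
  have hUinner : ∀ t x y, inner ℂ (U t x) y = inner ℂ x (U (-t) y) := by
    intro t x y
    refine tendsto_nhds_unique ((hU t x).inner tendsto_const_nhds) ?_
    simp only [(hG _).inner_map_left]
    exact Filter.Tendsto.inner tendsto_const_nhds (hU (-t) y)
  have hUadj : ∀ t, star (U t) = U (-t) := by
    intro t
    rw [ContinuousLinearMap.star_eq_adjoint]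
    refine ((ContinuousLinearMap.eq_adjoint_iff _ _).2 fun x y => ?_).symm
    rw [hUinner, neg_neg]
  have hest : ∀ x ∈ D, ∀ t, ‖U t x - x‖ ≤ ‖T x‖ * |t| := by
    intro x hx t
    refine le_of_tendsto_of_tendsto ((hU t x).sub_const x).norm ((hlim x hx).norm.mul_const |t|)
      (Filter.Eventually.of_forall fun n => ?_)
    have h := norm_boundedExp_sub_le (hB n) (B' := 0) (IsSelfAdjoint.zero _)
      (Commute.zero_right _) t x
    simpa [boundedExp] using h
  have hcont : ∀ x, Continuous fun t => U t x := by
    refine continuous_of_dense hUadd hUn hD fun x hx => ?_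
    rw [tendsto_iff_norm_sub_tendsto_zero]
    have hc : Filter.Tendsto (fun t : ℝ => ‖T x‖ * |t|) (nhds 0) (nhds 0) := by
      have : Continuous fun t : ℝ => ‖T x‖ * |t| := by fun_prop
      simpa using this.tendsto 0
    exact squeeze_zero (fun t => norm_nonneg _) (hest x hx) hc
  have hgroup : IsUnitaryGroup U := by
    refine ⟨hU0, hUadd, fun t => ?_, hcont⟩
    rw [Unitary.mem_iff, hUadj, ContinuousLinearMap.mul_def, ContinuousLinearMap.mul_def, ← hUadd,
      ← hUadd]
    simp [hU0]
  refine ⟨U, hgroup, fun x hx => ?_⟩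
  -- The derivative cannot be passed to the limit directly; the integrated equation can, by
  -- dominated convergence with bound `sup ‖B n x‖`.
  have hint : ∀ t : ℝ, U t x - x = ∫ s in (0 : ℝ)..t, U s (Complex.I • T x) := by
    intro t
    refine tendsto_nhds_unique ((hU t x).sub_const x) ?_
    have h1 : ∀ n, boundedExp (B n) t x - x =
        ∫ s in (0 : ℝ)..t, boundedExp (B n) s (Complex.I • B n x) := by
      intro n
      rw [intervalIntegral.integral_eq_sub_of_hasDerivAt
        (fun s _ => hasDerivAt_boundedExp_apply (B n) x s)
        (((hG n).continuous _).intervalIntegrable _ _), (hG n).map_zero]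
      rfl
    simp only [h1]
    obtain ⟨M, hM⟩ := (hlim x hx).norm.bddAbove_range
    refine intervalIntegral.tendsto_integral_filter_of_dominated_convergence (fun _ => M)
      (Filter.Eventually.of_forall fun n => ((hG n).continuous _).aestronglyMeasurable)
      (Filter.Eventually.of_forall fun n => Filter.Eventually.of_forall fun s _ => ?_)
      intervalIntegrable_const (Filter.Eventually.of_forall fun s _ => ?_)
    · rw [(hG n).norm_map, norm_smul, Complex.norm_I, one_mul]
      exact hM ⟨n, rfl⟩
    · have h2 : Filter.Tendsto (fun n => boundedExp (B n) s (Complex.I • B n x - Complex.I • T x))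
          Filter.atTop (nhds 0) := by
        rw [tendsto_zero_iff_norm_tendsto_zero]
        simp only [(hG _).norm_map]
        rw [← tendsto_zero_iff_norm_tendsto_zero]
        simpa using ((hlim x hx).const_smul Complex.I).sub_const (Complex.I • T x)
      have h3 := h2.add (hU s (Complex.I • T x))
      simpa only [map_sub, sub_add_cancel, zero_add] using h3
  have hd := intervalIntegral.integral_hasDerivAt_right
    ((hcont (Complex.I • T x)).intervalIntegrable 0 0)
    ((hcont _).stronglyMeasurableAtFilter _ _) (hcont _).continuousAt
  simp only [← hint, hU0, one_apply_eq_self] at hd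
  simpa using hd.add_const x

/-- **Stone's theorem**: every self-adjoint operator generates a unitary group. -/
theorem exists_isExpGroup (hA : IsSelfAdjoint A) : ∃ U : ℝ → E →L[ℂ] E, IsExpGroup A U := by
  obtain ⟨B, hB, hcomm, hlim⟩ := exists_bounded_approx hA
  classical
  obtain ⟨U, hU, hder⟩ := exists_isUnitaryGroup_of_approx hB hcomm hA.dense_domain
    (T := fun x => if hx : x ∈ A.domain then A ⟨x, hx⟩ else 0) (fun x hx => by
      have hx' : x ∈ A.domain := hx
      rw [dif_pos hx']
      exact hlim x _ (A.mem_graph ⟨x, hx'⟩))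
  have hder' : ∀ x y, (x, y) ∈ A.graph → HasDerivAt (fun t => U t x) (Complex.I • y) 0 := by
    intro x y hxy
    rw [LinearPMap.mem_graph_iff] at hxy
    obtain ⟨a, rfl, rfl⟩ := hxy
    simpa using hder a a.2
  refine ⟨U, hU.map_zero, hU.map_add, hU.mem_unitary, hU.continuous, fun ψ χ =>
    ⟨hder' ψ χ, fun h => mem_graph_of_isSelfAdjoint hA _ _ fun a b hab => ?_⟩⟩
  -- The generator is a symmetric extension of `A`, and a self-adjoint operator has no proper one.
  exact hU.inner_hasDerivAt_symm (hder' a b hab) h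

/-- For `x` in the domain, `U' (-s) (U s x)` has zero derivative. This needs `U s x` to stay in the
domain, which holds because `U s` commutes with the group. -/
theorem IsExpGroup.unique (hA : IsSelfAdjoint A) {U U' : ℝ → E →L[ℂ] E} (h : IsExpGroup A U)
    (h' : IsExpGroup A U') : U = U' := by
  have hU := h.isUnitaryGroup
  have hU' := h'.isUnitaryGroup
  funext t
  refine ContinuousLinearMap.ext_on (s := A.domain) ?_ fun x hx => ?_
  · rw [Submodule.span_eq]; exact hA.dense_domain
  have hx' := A.mem_graph ⟨x, hx⟩
  set y := A ⟨x, hx⟩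
  have hV : IsUnitaryGroup fun s => U' (-s) := by
    refine ⟨by simp [hU'.map_zero], fun s t => ?_, fun t => hU'.mem_unitary _, fun ψ =>
      (hU'.continuous ψ).comp continuous_neg⟩
    rw [neg_add, hU'.map_add]
  have hder : ∀ s : ℝ, HasDerivAt (fun s => U' (-s) (U s x)) 0 s := by
    intro s
    have h1 : HasDerivAt (fun s => U s x) (U s (Complex.I • y)) s :=
      hU.hasDerivAt ((h.mem_graph_iff _ _).1 hx') s
    have hg : (U s x, U s y) ∈ A.graph := by
      rw [h.mem_graph_iff]
      have h2 := ((U s).restrictScalars ℝ).hasFDerivAt.comp_hasDerivAt (0 : ℝ)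
        ((h.mem_graph_iff _ _).1 hx')
      rw [← map_smul]
      refine HasDerivAt.congr_of_eventuallyEq h2 (Filter.Eventually.of_forall fun r => ?_)
      exact hU.map_comm r s x
    have h3 := hU'.hasDerivAt_neg ((h'.mem_graph_iff _ _).1 hg) s
    have h4 := hV.hasDerivAt_apply h1 h3
    simpa only [map_smul, add_neg_cancel] using h4
  have hconst := is_const_of_deriv_eq_zero (fun s => (hder s).differentiableAt)
    (fun s => (hder s).deriv) t 0
  simp only [neg_zero, hU.map_zero, hU'.map_zero, one_apply_eq_self] at hconst
  calc U t x = U' t (U' (-t) (U t x)) := (hU'.map_map_neg t _).symm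
    _ = U' t x := by rw [hconst]

theorem existsUnique_isExpGroup (hA : IsSelfAdjoint A) :
    ∃! U : ℝ → E →L[ℂ] E, IsExpGroup A U := by
  obtain ⟨U, hU⟩ := exists_isExpGroup hA
  exact ⟨U, hU, fun U' hU' => hU'.unique hA hU⟩

end Stone

/-! ### Cauchy–Schwarz in time, and compactness by domination -/

section Auxiliary

theorem integral_norm_le_of_lintegral_sq_le {F : Type*} [NormedAddCommGroup F] {f : ℝ → F}
    (hf : Continuous f) {τ M : ℝ} (hτ : 0 ≤ τ) (hM : 0 ≤ M)
    (h : ∫⁻ s in Set.Icc 0 τ, ‖f s‖ₑ ^ 2 ≤ ENNReal.ofReal M ^ 2) :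
    ∫ s in (0 : ℝ)..τ, ‖f s‖ ≤ √τ * M := by
  set I₁ := ∫ s in (0 : ℝ)..τ, ‖f s‖ with hI₁
  have h2 : ∫ s in (0 : ℝ)..τ, ‖f s‖ ^ 2 ≤ M ^ 2 := by
    rw [intervalIntegral.integral_of_le hτ, ← integral_Icc_eq_integral_Ioc,
      integral_eq_lintegral_of_nonneg_ae (Filter.Eventually.of_forall fun s => by positivity)
        (by fun_prop)]
    refine ENNReal.toReal_le_of_le_ofReal (by positivity) ?_
    rw [ENNReal.ofReal_pow hM]
    refine le_trans (le_of_eq ?_) h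
    refine lintegral_congr fun s => ?_
    rw [ENNReal.ofReal_pow (norm_nonneg _), ofReal_norm]
  rcases hτ.eq_or_lt with rfl | hτ
  · simp [hI₁]
  -- Cauchy–Schwarz against the constant function, as nonnegativity of `τ²` times the variance of
  -- `‖f‖`, up to the factor `τ`.
  have hnn : 0 ≤ ∫ s in (0 : ℝ)..τ, (τ * ‖f s‖ - I₁) ^ 2 :=
    intervalIntegral.integral_nonneg hτ.le fun s _ => sq_nonneg _
  have hexp : ∫ s in (0 : ℝ)..τ, (τ * ‖f s‖ - I₁) ^ 2 =
      τ ^ 2 * (∫ s in (0 : ℝ)..τ, ‖f s‖ ^ 2) - 2 * τ * I₁ * I₁ + τ * I₁ ^ 2 := by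
    have e : ∀ s, (τ * ‖f s‖ - I₁) ^ 2 =
        τ ^ 2 * ‖f s‖ ^ 2 - 2 * τ * I₁ * ‖f s‖ + I₁ ^ 2 := fun s => by ring
    simp only [e]
    rw [intervalIntegral.integral_add, intervalIntegral.integral_sub,
      intervalIntegral.integral_const_mul, intervalIntegral.integral_const_mul,
      intervalIntegral.integral_const, smul_eq_mul, sub_zero]
    all_goals exact Continuous.intervalIntegrable (by fun_prop) _ _
  have hle : I₁ ^ 2 ≤ τ * M ^ 2 := by
    rw [hexp] at hnn
    have h3 : τ * I₁ ^ 2 ≤ τ * (τ * M ^ 2) := by nlinarith [sq_nonneg τ]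
    exact le_of_mul_le_mul_left h3 hτ
  rw [← Real.sqrt_sq hM, ← Real.sqrt_mul hτ.le]
  exact Real.le_sqrt_of_sq_le hle

variable {E : Type*} [NormedAddCommGroup E] [InnerProductSpace ℂ E]

theorem norm_le_of_dense_inner_le {α : Type*} {ι : α → E} (hι : DenseRange ι) {x : E} {M : ℝ}
    (hM : 0 ≤ M) (h : ∀ a, ‖inner ℂ (ι a) x‖ ≤ ‖ι a‖ * M) : ‖x‖ ≤ M := by
  have h1 : ‖inner ℂ x x‖ ≤ ‖x‖ * M :=
    hι.induction_on (p := fun y => ‖inner ℂ y x‖ ≤ ‖y‖ * M) x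
      (isClosed_le (by fun_prop) (by fun_prop)) h
  rw [inner_self_eq_norm_sq_to_K] at h1
  rcases eq_or_ne x 0 with rfl | hx
  · simpa using hM
  · have hx' : 0 < ‖x‖ := norm_pos_iff.2 hx
    refine le_of_mul_le_mul_left ?_ hx'
    refine le_trans (le_of_eq ?_) h1
    simp [sq]

/-- A finite net for the image of the unit ball under `C`, with centres in that image, pulls back to
points of the ball whose images under `K` form a net. -/
theorem isCompactOperator_of_norm_le [CompleteSpace E] {K C : E →L[ℂ] E} (hC : IsCompactOperator C)
    {c : ℝ} (hc : 0 ≤ c) (h : ∀ x, ‖K x‖ ≤ c * ‖C x‖) : IsCompactOperator K := by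
  refine (isCompactOperator_iff_isCompact_closure_image_closedBall (K : E →ₗ[ℂ] E) one_pos).2 ?_
  have hC' := (isCompactOperator_iff_isCompact_closure_image_closedBall (C : E →ₗ[ℂ] E)
    one_pos).1 hC
  refine TotallyBounded.isCompact_of_isClosed (TotallyBounded.closure ?_) isClosed_closure
  have htb : TotallyBounded ((C : E →ₗ[ℂ] E) '' Metric.closedBall 0 1) :=
    hC'.totallyBounded.subset subset_closure
  refine Metric.totallyBounded_iff.2 fun ε hε => ?_
  obtain ⟨t, ht, htf, hcov⟩ := Metric.finite_approx_of_totallyBounded htb (ε / (c + 1))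
    (by positivity)
  choose! p hp using fun y (hy : y ∈ t) => ht hy
  refine ⟨(fun y => K (p y)) '' t, htf.image _, ?_⟩
  rintro _ ⟨x, hx, rfl⟩
  have hmem := hcov ⟨x, hx, rfl⟩
  simp only [Set.mem_iUnion, exists_prop] at hmem
  obtain ⟨y, hy, hxy⟩ := hmem
  simp only [Set.mem_iUnion, exists_prop]
  refine ⟨K (p y), ⟨y, hy, rfl⟩, ?_⟩
  rw [Metric.mem_ball, dist_eq_norm] at *
  rw [← (hp y hy).2, ← map_sub, lt_div_iff₀ (by positivity)] at hxy
  have h1 := h (x - p y)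
  rw [ContinuousLinearMap.coe_coe, ← map_sub]
  rw [ContinuousLinearMap.coe_coe] at hxy
  nlinarith [norm_nonneg (C (x - p y))]

end Auxiliary

/-! ### Abstract free evolutions and the bound on the potential -/

section FreeEvolution

variable {E S : Type*} [NormedAddCommGroup E] [InnerProductSpace ℂ E] [CompleteSpace E]
  [AddCommGroup S] [Module ℂ S]

/-- The unitary group `G` leaves the image under `ι` of the space `S` invariant, acting on `S` as
`g`, and is generated there by `i h`. -/
structure IsFreeEvolution (ι : S →ₗ[ℂ] E) (h : S →ₗ[ℂ] S) (G : ℝ → E →L[ℂ] E) (g : ℝ → S → S) :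
    Prop where
  group : IsUnitaryGroup G
  dense : DenseRange ι
  injective : Function.Injective ι
  map_eq : ∀ t Φ, ι (g t Φ) = G t (ι Φ)
  hasDerivAt : ∀ Φ, HasDerivAt (fun t => G t (ι Φ)) (Complex.I • ι (h Φ)) 0

namespace IsFreeEvolution

variable {ι : S →ₗ[ℂ] E} {h : S →ₗ[ℂ] S} {G : ℝ → E →L[ℂ] E} {g : ℝ → S → S}

theorem map_generator (hF : IsFreeEvolution ι h G g)
    (t : ℝ) (Φ : S) : ι (h (g t Φ)) = G t (ι (h Φ)) := by
  have h1 := hF.hasDerivAt (g t Φ)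
  have h2 := ((G t).restrictScalars ℝ).hasFDerivAt.comp_hasDerivAt (0 : ℝ) (hF.hasDerivAt Φ)
  have h3 : HasDerivAt (fun s => G s (ι (g t Φ))) (G t (Complex.I • ι (h Φ))) 0 := by
    refine HasDerivAt.congr_of_eventuallyEq h2 (Filter.Eventually.of_forall fun r => ?_)
    simp only [hF.map_eq]
    exact hF.group.map_comm r t _
  have h4 := h1.unique h3
  rw [map_smul] at h4
  exact smul_right_injective E Complex.I_ne_zero h4

theorem inner_generator (hF : IsFreeEvolution ι h G g)
    (Φ Ψ : S) : inner ℂ (ι (h Φ)) (ι Ψ) = inner ℂ (ι Φ) (ι (h Ψ)) :=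
  hF.group.inner_hasDerivAt_symm (hF.hasDerivAt Φ) (hF.hasDerivAt Ψ)

/-- Invariance of the core makes `f t = ⟨χ, G t (ι Φ)⟩` satisfy `f' = r f`, so `f` is a multiple of
`e^{rt}`. As `f` is bounded on the whole line, it vanishes. -/
theorem eq_zero_of_inner_range (hF : IsFreeEvolution ι h G g) {r : ℝ} (hr : r ≠ 0) {χ : E}
    (hχ : ∀ Φ, inner ℂ χ (ι (h Φ) + (r * Complex.I) • ι Φ) = 0) : χ = 0 := by
  refine Dense.eq_zero_of_inner_left ℂ hF.dense ?_
  rintro _ ⟨Φ, rfl⟩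
  set f : ℝ → ℂ := fun t => inner ℂ χ (G t (ι Φ)) with hf
  have hder : ∀ t, HasDerivAt f (r * f t) t := by
    intro t
    have h1 := HasDerivAt.inner ℂ (hasDerivAt_const t χ) (hF.group.hasDerivAt (hF.hasDerivAt Φ) t)
    refine h1.congr_deriv ?_
    have h2 := hχ (g t Φ)
    rw [inner_add_right, inner_smul_right, hF.map_generator, hF.map_eq] at h2
    rw [inner_zero_left, add_zero, map_smul, inner_smul_right, eq_neg_of_add_eq_zero_left h2, hf]
    linear_combination (-(r : ℂ) * inner ℂ χ (G t (ι Φ))) * Complex.I_mul_I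
  have hconst : ∀ t, Complex.exp (-(r * t : ℝ)) * f t = f 0 := by
    intro t
    have hd : ∀ t : ℝ, HasDerivAt (fun t : ℝ => Complex.exp (-(r * t : ℝ)) * f t) 0 t := by
      intro t
      have h1 : HasDerivAt (fun t : ℝ => Complex.exp (-(r * t : ℝ)))
          (Complex.exp (-(r * t : ℝ)) * -(r : ℂ)) t := by
        have h0 : HasDerivAt (fun t : ℝ => (-(r * t : ℝ) : ℂ)) (-(r : ℂ)) t := by
          have := (((hasDerivAt_id t).const_mul r).ofReal_comp).fun_neg
          simpa using this
        exact h0.cexp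
      refine (h1.mul (hder t)).congr_deriv ?_
      ring
    have := is_const_of_deriv_eq_zero (fun s => (hd s).differentiableAt) (fun s => (hd s).deriv) t 0
    simpa using this
  have hbound : ∀ t, ‖f 0‖ ≤ Real.exp (-(r * t)) * (‖χ‖ * ‖ι Φ‖) := by
    intro t
    rw [← hconst t, norm_mul, ← Complex.ofReal_neg, Complex.norm_exp_ofReal]
    gcongr
    exact (norm_inner_le_norm _ _).trans (by rw [hF.group.norm_map])
  have hlim : Filter.Tendsto (fun n : ℕ => Real.exp (-(n : ℝ)) * (‖χ‖ * ‖ι Φ‖)) Filter.atTop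
      (nhds 0) := by
    have := (Real.tendsto_exp_neg_atTop_nhds_zero.comp
      (tendsto_natCast_atTop_atTop (R := ℝ))).mul_const (‖χ‖ * ‖ι Φ‖)
    simpa using this
  -- The times `n / r` make `r t = n` for either sign of `r`.
  have h0 : ‖f 0‖ ≤ 0 := ge_of_tendsto' hlim fun n => by
    have := hbound (n / r)
    rwa [mul_div_cancel₀ _ hr] at this
  have := norm_le_zero_iff.1 h0
  simpa [hf, hF.group.map_zero] using this

theorem dense_range_generator (hF : IsFreeEvolution ι h G g) {r : ℝ} (hr : r ≠ 0) :
    DenseRange fun Φ => ι (h Φ) + (r * Complex.I) • ι Φ := by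
  have hd : Dense ((LinearMap.range (ι ∘ₗ h + (r * Complex.I) • ι) : Submodule ℂ E) : Set E) := by
    rw [Submodule.dense_iff_topologicalClosure_eq_top,
      Submodule.topologicalClosure_eq_top_iff, Submodule.eq_bot_iff]
    intro χ hχ
    rw [Submodule.mem_orthogonal'] at hχ
    exact hF.eq_zero_of_inner_range hr fun Φ => hχ _ ⟨Φ, rfl⟩
  exact hd

variable {v : S →ₗ[ℂ] E}

/-- Symmetry of `v` lets the bound on `v (g (-s) Φ)` be used, while the form with `v` on the fixed
vector `Ψ` is continuous in `s` before any regularity of `s ↦ v (g (-s) Φ)` is known. -/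
theorem integral_inner_le (hF : IsFreeEvolution ι h G g)
    (hv : ∀ Φ Ψ, inner ℂ (ι Ψ) (v Φ) = inner ℂ (v Ψ) (ι Φ))
    {M τ : ℝ} (hM : 0 ≤ M) (hτ : 0 ≤ τ) (Φ Ψ : S)
    (hb : ∫⁻ s in Set.Icc (0 : ℝ) τ, ‖v (g (-s) Φ)‖ₑ ^ 2 ≤ ENNReal.ofReal M ^ 2) :
    ∫ s in (0 : ℝ)..τ, ‖inner ℂ (v Ψ) (G (-s) (ι Φ))‖ ≤ √τ * (‖ι Ψ‖ * M) := by
  refine integral_norm_le_of_lintegral_sq_le ?_ hτ (by positivity) ?_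
  · have := (hF.group.continuous (ι Φ)).comp continuous_neg
    exact Continuous.inner continuous_const this
  · calc ∫⁻ s in Set.Icc (0 : ℝ) τ, ‖inner ℂ (v Ψ) (G (-s) (ι Φ))‖ₑ ^ 2
        ≤ ∫⁻ s in Set.Icc (0 : ℝ) τ, ‖ι Ψ‖ₑ ^ 2 * ‖v (g (-s) Φ)‖ₑ ^ 2 := by
          refine lintegral_mono fun s => ?_
          simp only
          rw [← mul_pow, ← hF.map_eq, ← hv]
          gcongr
          rw [← ofReal_norm, ← ofReal_norm, ← ofReal_norm, ← ENNReal.ofReal_mul (norm_nonneg _)]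
          exact ENNReal.ofReal_le_ofReal (norm_inner_le_norm _ _)
      _ = ‖ι Ψ‖ₑ ^ 2 * ∫⁻ s in Set.Icc (0 : ℝ) τ, ‖v (g (-s) Φ)‖ₑ ^ 2 :=
          lintegral_const_mul' _ _ (by finiteness)
      _ ≤ ‖ι Ψ‖ₑ ^ 2 * ENNReal.ofReal M ^ 2 := by gcongr
      _ = ENNReal.ofReal (‖ι Ψ‖ * M) ^ 2 := by
          rw [ENNReal.ofReal_mul (norm_nonneg _), mul_pow, ofReal_norm]

/-- The value at time `0` is recovered from time averages of a function and its derivative. Dividing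
by `τ` gives the coefficient `K√τ` for the generator, small with `τ`. -/
theorem norm_potential_le (hF : IsFreeEvolution ι h G g)
    (hv : ∀ Φ Ψ, inner ℂ (ι Ψ) (v Φ) = inner ℂ (v Ψ) (ι Φ)) {K τ : ℝ} (hK : 0 ≤ K) (hτ : 0 < τ)
    (hb : ∀ Φ, ∫⁻ s in Set.Icc (0 : ℝ) τ, ‖v (g (-s) Φ)‖ₑ ^ 2 ≤ ENNReal.ofReal (K * ‖ι Φ‖) ^ 2)
    (Φ : S) : τ * ‖v Φ‖ ≤ √τ * K * (‖ι Φ‖ + τ * ‖ι (h Φ)‖) := by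
  rw [← le_div_iff₀' hτ]
  refine norm_le_of_dense_inner_le hF.dense (by positivity) fun Ψ => ?_
  rw [hv]
  set f : ℝ → ℂ := fun s => inner ℂ (v Ψ) (G (-s) (ι Φ)) with hf
  set f' : ℝ → ℂ := fun s => inner ℂ (v Ψ) (G (-s) (ι (h Φ))) with hf'
  have hcf : Continuous f :=
    Continuous.inner continuous_const ((hF.group.continuous (ι Φ)).comp continuous_neg)
  have hcf' : Continuous f' :=
    Continuous.inner continuous_const ((hF.group.continuous (ι (h Φ))).comp continuous_neg)
  -- The weight `τ - s` vanishes at the right endpoint, so only the value at `0` survives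
  -- integration.
  have hder : ∀ s, HasDerivAt (fun s : ℝ => ((τ - s : ℝ) : ℂ) * f s)
      (-f s - ((τ - s : ℝ) : ℂ) * (Complex.I * f' s)) s := by
    intro s
    have h1 : HasDerivAt f (-(Complex.I * f' s)) s := by
      have := HasDerivAt.inner ℂ (hasDerivAt_const s (v Ψ))
        (hF.group.hasDerivAt_neg (hF.hasDerivAt Φ) s)
      refine this.congr_deriv ?_
      rw [inner_zero_left, add_zero, inner_neg_right, map_smul, inner_smul_right]
    have h2 : HasDerivAt (fun s : ℝ => ((τ - s : ℝ) : ℂ)) (-1) s := by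
      simpa using ((hasDerivAt_id s).const_sub τ).ofReal_comp
    refine (h2.mul h1).congr_deriv ?_
    ring
  have hint := intervalIntegral.integral_eq_sub_of_hasDerivAt (fun s _ => hder s)
    ((by fun_prop : Continuous fun s : ℝ =>
      -f s - ((τ - s : ℝ) : ℂ) * (Complex.I * f' s)).intervalIntegrable 0 τ)
  have hle : τ * ‖f 0‖ ≤ ∫ s in (0 : ℝ)..τ, (‖f s‖ + τ * ‖f' s‖) := by
    have e : τ * ‖f 0‖ = ‖∫ s in (0 : ℝ)..τ, (-f s - ((τ - s : ℝ) : ℂ) * (Complex.I * f' s))‖ := by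
      rw [hint]
      simp [abs_of_pos hτ]
    rw [e]
    refine intervalIntegral.norm_integral_le_of_norm_le hτ.le
      (Filter.Eventually.of_forall fun s hs => ?_)
      ((by fun_prop : Continuous fun s => ‖f s‖ + τ * ‖f' s‖).intervalIntegrable _ _)
    refine (norm_sub_le _ _).trans ?_
    rw [norm_neg, norm_mul, norm_mul, Complex.norm_I, one_mul, Complex.norm_real,
      Real.norm_eq_abs, abs_of_nonneg (by linarith [hs.2])]
    gcongr
    linarith [hs.1]
  rw [intervalIntegral.integral_add (hcf.norm.intervalIntegrable _ _)
    ((hcf'.norm.const_mul τ).intervalIntegrable _ _), intervalIntegral.integral_const_mul] at hle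
  have b1 := hF.integral_inner_le hv (by positivity) hτ.le Φ Ψ (hb Φ)
  have b2 := hF.integral_inner_le hv (by positivity) hτ.le (h Φ) Ψ (hb (h Φ))
  have hf0 : f 0 = inner ℂ (v Ψ) (ι Φ) := by simp [hf, hF.group.map_zero]
  rw [← hf0, mul_div_assoc', le_div_iff₀' hτ]
  refine hle.trans ((add_le_add b1 (mul_le_mul_of_nonneg_left b2 hτ.le)).trans (le_of_eq ?_))
  ring

end IsFreeEvolution

end FreeEvolution

/-! ### Kato–Rellich and compactness of the difference of evolutions -/

section Perturbation

variable {E S : Type*} [NormedAddCommGroup E] [InnerProductSpace ℂ E] [CompleteSpace E]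
  [AddCommGroup S] [Module ℂ S]

namespace IsFreeEvolution

variable {ι : S →ₗ[ℂ] E} {h : S →ₗ[ℂ] S} {G : ℝ → E →L[ℂ] E} {g : ℝ → S → S} {v : S →ₗ[ℂ] E}

/-- For `|r| ≥ 4b` the relative bound gives `‖v Φ‖ ≤ ½ ‖(h + ir) Φ‖`. If `χ` is orthogonal to the
perturbed range, its pairing with `(h + ir) Φ` equals minus that with `v Φ`; the free range being
dense, `‖χ‖ ≤ ½ ‖χ‖`. -/
theorem dense_range_perturbed (hF : IsFreeEvolution ι h G g)
    {b r : ℝ} (hr : 4 * b ≤ |r|) (hr0 : r ≠ 0)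
    (hb : ∀ Φ, ‖v Φ‖ ≤ 1 / 4 * ‖ι (h Φ)‖ + b * ‖ι Φ‖) :
    DenseRange fun Φ => (ι (h Φ) + v Φ) + (r * Complex.I) • ι Φ := by
  have hd : Dense ((LinearMap.range (ι ∘ₗ h + v + (r * Complex.I) • ι) :
      Submodule ℂ E) : Set E) := by
    rw [Submodule.dense_iff_topologicalClosure_eq_top,
      Submodule.topologicalClosure_eq_top_iff, Submodule.eq_bot_iff]
    intro χ hχ
    rw [Submodule.mem_orthogonal'] at hχ
    have hle : ∀ Φ, ‖inner ℂ (ι (h Φ) + (r * Complex.I) • ι Φ) χ‖ ≤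
        ‖ι (h Φ) + (r * Complex.I) • ι Φ‖ * (1 / 2 * ‖χ‖) := by
      intro Φ
      have h1 : inner ℂ χ (ι (h Φ) + v Φ + (r * Complex.I) • ι Φ) = 0 := hχ _ ⟨Φ, rfl⟩
      have h2 : inner ℂ χ (ι (h Φ) + (r * Complex.I) • ι Φ) = - inner ℂ χ (v Φ) := by
        rw [eq_neg_iff_add_eq_zero, ← inner_add_right, ← h1]
        congr 1; abel
      rw [norm_inner_symm, h2, norm_neg]
      refine (norm_inner_le_norm _ _).trans ?_
      have hsq := norm_add_I_smul_sq (hF.inner_generator Φ Φ) r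
      have e1 : ‖ι (h Φ)‖ ≤ ‖ι (h Φ) + (r * Complex.I) • ι Φ‖ := by
        refine le_of_sq_le_sq ?_ (norm_nonneg _)
        rw [hsq]
        exact le_add_of_nonneg_right (by positivity)
      have e2 : |r| * ‖ι Φ‖ ≤ ‖ι (h Φ) + (r * Complex.I) • ι Φ‖ := by
        refine le_of_sq_le_sq ?_ (norm_nonneg _)
        rw [hsq, mul_pow, sq_abs]
        exact le_add_of_nonneg_left (by positivity)
      have e3 : ‖v Φ‖ ≤ 1 / 2 * ‖ι (h Φ) + (r * Complex.I) • ι Φ‖ := by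
        nlinarith [hb Φ, norm_nonneg (ι Φ)]
      nlinarith [norm_nonneg χ]
    have h2 := norm_le_of_dense_inner_le (hF.dense_range_generator hr0) (by positivity) hle
    exact norm_le_zero_iff.1 (by linarith)
  exact hd

variable {A : E →ₗ.[ℂ] E}

/-- Duhamel's formula: in the derivative of `U s (G (-s) (ι Φ))` the free generator cancels and only
`v` remains. -/
theorem norm_wave_sub_le (hF : IsFreeEvolution ι h G g)
    (hA : ∀ p, p ∈ A.graph ↔ ∃ Φ, (ι Φ, ι (h Φ) + v Φ) = p)
    {b : ℝ} (hb : ∀ Φ, ‖v Φ‖ ≤ 1 / 4 * ‖ι (h Φ)‖ + b * ‖ι Φ‖)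
    {U : ℝ → E →L[ℂ] E} (hU : IsExpGroup A.closure U) {t M : ℝ} (ht : 0 ≤ t) (hM : 0 ≤ M) (Φ : S)
    (hVM : ∫⁻ s in Set.Icc (0 : ℝ) t, ‖v (g (-s) Φ)‖ₑ ^ 2 ≤ ENNReal.ofReal M ^ 2) :
    ‖U t (G (-t) (ι Φ)) - ι Φ‖ ≤ √t * M := by
  have hUg := hU.isUnitaryGroup
  have hcι : ∀ Φ, Continuous fun s => G (-s) (ι Φ) := fun Φ =>
    (hF.group.continuous (ι Φ)).comp continuous_neg
  -- The free orbit is continuous in the graph norm of the generator, and the relative bound makes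
  -- `v` continuous for that norm.
  have hcont : Continuous fun s => v (g (-s) Φ) := by
    refine continuous_iff_continuousAt.2 fun s₀ => ?_
    rw [ContinuousAt, tendsto_iff_norm_sub_tendsto_zero]
    have hlim : Filter.Tendsto (fun s => 1 / 4 * ‖G (-s) (ι (h Φ)) - G (-s₀) (ι (h Φ))‖ +
        b * ‖G (-s) (ι Φ) - G (-s₀) (ι Φ)‖) (nhds s₀) (nhds 0) := by
      have hc : Continuous fun s => 1 / 4 * ‖G (-s) (ι (h Φ)) - G (-s₀) (ι (h Φ))‖ +
          b * ‖G (-s) (ι Φ) - G (-s₀) (ι Φ)‖ :=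
        (((hcι (h Φ)).sub continuous_const).norm.const_mul (1 / 4)).add
          (((hcι Φ).sub continuous_const).norm.const_mul b)
      simpa using hc.tendsto s₀
    refine squeeze_zero (fun s => norm_nonneg _) (fun s => ?_) hlim
    rw [← map_sub]
    refine (hb _).trans (le_of_eq ?_)
    simp only [map_sub, hF.map_generator, hF.map_eq]
  have hder : ∀ s, HasDerivAt (fun s => U s (G (-s) (ι Φ))) (U s (Complex.I • v (g (-s) Φ))) s := by
    intro s
    have hg : (ι (g (-s) Φ), ι (h (g (-s) Φ)) + v (g (-s) Φ)) ∈ A.closure.graph :=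
      LinearPMap.le_graph_of_le A.le_closure ((hA _).2 ⟨_, rfl⟩)
    have h1 := hUg.hasDerivAt ((hU.mem_graph_iff _ _).1 hg) s
    rw [hF.map_eq, hF.map_generator] at h1
    refine (hUg.hasDerivAt_apply (hF.group.hasDerivAt_neg (hF.hasDerivAt Φ) s) h1).congr_deriv ?_
    rw [← map_add, map_smul (G (-s)), smul_add, neg_add_cancel_left]
  have hcU : Continuous fun s => U s (Complex.I • v (g (-s) Φ)) :=
    hUg.continuous_apply continuous_id (hcont.const_smul _)
  have hint := intervalIntegral.integral_eq_sub_of_hasDerivAt (fun s _ => hder s)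
    (hcU.intervalIntegrable 0 t)
  have hn : ∀ s, ‖U s (Complex.I • v (g (-s) Φ))‖ = ‖v (g (-s) Φ)‖ := fun s => by
    rw [hUg.norm_map, norm_smul, Complex.norm_I, one_mul]
  have hfin := intervalIntegral.norm_integral_le_integral_norm (μ := volume)
    (f := fun s => U s (Complex.I • v (g (-s) Φ))) ht
  rw [hint] at hfin
  simp only [hn, neg_zero, hUg.map_zero, hF.group.map_zero, one_apply_eq_self] at hfin
  exact hfin.trans (integral_norm_le_of_lintegral_sq_le hcont ht hM hVM)

/-- The perturbed and the free evolution differ by a compact operator. -/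
theorem isCompactOperator_wave_sub (hF : IsFreeEvolution ι h G g)
    (hA : ∀ p, p ∈ A.graph ↔ ∃ Φ, (ι Φ, ι (h Φ) + v Φ) = p) {C : ℝ → E →L[ℂ] E}
    (hC : ∀ t, 0 ≤ t → IsCompactOperator (C t))
    (hVC : ∀ t, 0 ≤ t → ∀ Φ,
      ∫⁻ s in Set.Icc (0 : ℝ) t, ‖v (g (-s) Φ)‖ₑ ^ 2 ≤ ‖C t (ι Φ)‖ₑ ^ 2)
    {b : ℝ} (hb : ∀ Φ, ‖v Φ‖ ≤ 1 / 4 * ‖ι (h Φ)‖ + b * ‖ι Φ‖)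
    {U : ℝ → E →L[ℂ] E} (hU : IsExpGroup A.closure U) (t : ℝ) :
    IsCompactOperator (U t ∘L G (-t) - 1 : E →L[ℂ] E) := by
  have hpos : ∀ t, 0 ≤ t → IsCompactOperator (U t ∘L G (-t) - 1 : E →L[ℂ] E) := by
    intro t ht
    refine isCompactOperator_of_norm_le (hC t ht) (Real.sqrt_nonneg t) fun x => ?_
    refine hF.dense.induction_on (p := fun x => ‖(U t ∘L G (-t) - 1 : E →L[ℂ] E) x‖ ≤
      √t * ‖C t x‖) x (isClosed_le (by fun_prop) (by fun_prop)) fun Φ => ?_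
    refine hF.norm_wave_sub_le hA hb hU ht (norm_nonneg _) Φ ?_
    rw [ofReal_norm]
    exact hVC t ht Φ
  rcases le_total 0 t with ht | ht
  · exact hpos t ht
  -- Negative times reduce to positive ones by `U t G (-t) - 1 = -U t (U (-t) G t - 1) G (-t)`.
  · have hc := ((hpos (-t) (neg_nonneg.2 ht)).comp_clm (G (-t))).clm_comp (-U t)
    have e : ⇑(U t ∘L G (-t) - 1 : E →L[ℂ] E) =
        ⇑(-U t) ∘ ⇑(U (-t) ∘L G (- -t) - 1 : E →L[ℂ] E) ∘ ⇑(G (-t)) := by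
      funext x
      have h1 := hF.group.map_map_neg t x
      have h2 := hU.isUnitaryGroup.map_map_neg t
      simp only [Function.comp_apply, sub_apply, ContinuousLinearMap.comp_apply, one_apply_eq_self,
        neg_apply, neg_neg, map_sub, h1, h2]
      abel
    rw [e]
    exact hc

/-- `v` has relative bound less than one with respect to the free generator. -/
theorem exists_relative_bound (hF : IsFreeEvolution ι h G g)
    (hv : ∀ Φ Ψ, inner ℂ (ι Ψ) (v Φ) = inner ℂ (v Ψ) (ι Φ)) {K : ℝ} (hK : 0 ≤ K)
    (hb : ∀ Φ, ∫⁻ s in Set.Icc (0 : ℝ) 1, ‖v (g (-s) Φ)‖ₑ ^ 2 ≤ ENNReal.ofReal (K * ‖ι Φ‖) ^ 2) :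
    ∃ b : ℝ, ∀ Φ, ‖v Φ‖ ≤ 1 / 4 * ‖ι (h Φ)‖ + b * ‖ι Φ‖ := by
  -- The time is `τ = q²`, so that `√τ = q`: then `K√τ ≤ 1/4`, and `τ ≤ 1` keeps the integral within
  -- `[0, 1]`.
  set q : ℝ := 1 / (4 * K + 1) with hq
  have hq0 : 0 < q := by positivity
  have hq1 : q ≤ 1 := by
    rw [hq, div_le_one (by positivity)]; linarith
  have hqK : K * q ≤ 1 / 4 := by
    rw [hq, mul_one_div, div_le_div_iff₀ (by positivity) (by norm_num)]; linarith
  refine ⟨K / q, fun Φ => ?_⟩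
  have hle := hF.norm_potential_le hv hK (τ := q ^ 2) (by positivity) (fun Φ => by
    refine le_trans (lintegral_mono_set (Set.Icc_subset_Icc_right ?_)) (hb Φ)
    nlinarith) Φ
  rw [Real.sqrt_sq hq0.le] at hle
  have h1 : ‖v Φ‖ ≤ K / q * ‖ι Φ‖ + K * q * ‖ι (h Φ)‖ := by
    have h2 : q ^ 2 * ‖v Φ‖ ≤ q ^ 2 * (K / q * ‖ι Φ‖ + K * q * ‖ι (h Φ)‖) := by
      refine hle.trans (le_of_eq ?_)
      field_simp
    exact le_of_mul_le_mul_left h2 (by positivity)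
  nlinarith [norm_nonneg (ι (h Φ))]

/-- The Kato–Rellich theorem. -/
theorem isEssentiallySelfAdjoint (hF : IsFreeEvolution ι h G g)
    (hv : ∀ Φ Ψ, inner ℂ (ι Ψ) (v Φ) = inner ℂ (v Ψ) (ι Φ))
    (hA : ∀ p, p ∈ A.graph ↔ ∃ Φ, (ι Φ, ι (h Φ) + v Φ) = p) {b : ℝ}
    (hb : ∀ Φ, ‖v Φ‖ ≤ 1 / 4 * ‖ι (h Φ)‖ + b * ‖ι Φ‖) : IsEssentiallySelfAdjoint A := by
  have hs : A.IsFormalAdjoint A := by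
    intro x y
    obtain ⟨Φ, hΦ⟩ := (hA _).1 (A.mem_graph x)
    obtain ⟨Ψ, hΨ⟩ := (hA _).1 (A.mem_graph y)
    rw [Prod.mk.injEq] at hΦ hΨ
    rw [← hΦ.1, ← hΦ.2, ← hΨ.1, ← hΨ.2, inner_add_left, inner_add_right, hF.inner_generator, hv]
  have hdom : Dense (A.domain : Set E) := by
    refine Dense.mono ?_ hF.dense
    rintro _ ⟨Φ, rfl⟩
    exact LinearPMap.mem_domain_of_mem_graph ((hA _).2 ⟨Φ, rfl⟩)
  have hrpos : 0 < 4 * |b| + 1 := by positivity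
  have hrange : ∀ r : ℝ, |r| = 4 * |b| + 1 →
      Dense {z : E | ∃ x y, (x, y) ∈ A.graph ∧ y + (r * Complex.I) • x = z} := by
    intro r hr
    have h1 := hF.dense_range_perturbed (r := r) (b := b) (by rw [hr]; linarith [le_abs_self b])
      (by rintro rfl; rw [abs_zero] at hr; linarith) hb
    refine Dense.mono ?_ h1
    rintro _ ⟨Φ, rfl⟩
    exact ⟨_, _, (hA _).2 ⟨Φ, rfl⟩, rfl⟩
  exact isEssentiallySelfAdjoint_of_dense_range hs hdom hrpos.ne' (hrange _ (abs_of_pos hrpos))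
    (hrange _ (by rw [abs_neg, abs_of_pos hrpos]))

end IsFreeEvolution

end Perturbation

/-! ### The phase `e^{itp²}`: growth and Taylor estimates -/

section FreePhase

theorem norm_freePhase (t ξ : ℝ) : ‖freePhase t ξ‖ = 1 := by
  rw [freePhase, mul_comm, Complex.norm_exp_ofReal_mul_I]

theorem freePhase_zero (ξ : ℝ) : freePhase 0 ξ = 1 := by simp [freePhase]

theorem freePhase_add (s t ξ : ℝ) : freePhase (s + t) ξ = freePhase s ξ * freePhase t ξ := by
  rw [freePhase, freePhase, freePhase, ← Complex.exp_add]
  congr 1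
  push_cast
  ring

/-- All derivatives are bounded by one. Composed with a polynomial, this shows that the free phase
multiplies the Schwartz space into itself. -/
theorem hasTemperateGrowth_exp_I_mul :
    Function.HasTemperateGrowth fun x : ℝ => Complex.exp (Complex.I * x) := by
  have hder : ∀ n : ℕ, iteratedDeriv n (fun x : ℝ => Complex.exp (Complex.I * x)) =
      fun x : ℝ => Complex.I ^ n * Complex.exp (Complex.I * x) := by
    intro n
    induction n with
    | zero => simp
    | succ n ih =>
      rw [iteratedDeriv_succ, ih]
      funext x
      have h0 : HasDerivAt (fun x : ℝ => Complex.I * (x : ℂ)) Complex.I x := by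
        simpa using (Complex.ofRealCLM.hasDerivAt (x := x)).const_mul Complex.I
      rw [((h0.cexp).const_mul (Complex.I ^ n)).deriv]
      ring
  refine ⟨(contDiff_const.mul Complex.ofRealCLM.contDiff).cexp, fun n => ⟨0, 1, fun x => ?_⟩⟩
  rw [norm_iteratedFDeriv_eq_norm_iteratedDeriv, hder, norm_mul, norm_pow, Complex.norm_I,
    mul_comm Complex.I, Complex.norm_exp_ofReal_mul_I]
  simp

theorem hasTemperateGrowth_freePhase (t : ℝ) : (freePhase t).HasTemperateGrowth := by
  have h : Function.HasTemperateGrowth fun ξ : ℝ => t * (2 * Real.pi * ξ) ^ 2 := by fun_prop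
  exact hasTemperateGrowth_exp_I_mul.comp h

/-- Taylor's estimate covers `|x| ≤ 1`; for larger `|x|` the trivial bound `2|x|` is at most `2x²`.
-/
theorem norm_exp_I_mul_sub_le (x : ℝ) :
    ‖Complex.exp (Complex.I * x) - 1 - Complex.I * x‖ ≤ 2 * x ^ 2 := by
  have hx : ‖Complex.I * (x : ℂ)‖ = |x| := by simp
  rcases le_total |x| 1 with h | h
  · have h1 := Complex.norm_exp_sub_one_sub_id_le (x := Complex.I * x) (by rwa [hx])
    rw [hx, sq_abs] at h1
    nlinarith [sq_nonneg x]
  · have h1 := norm_sub_le (Complex.exp (Complex.I * x) - 1) (Complex.I * x)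
    have h2 := Real.norm_exp_I_mul_ofReal_sub_one_le (x := x)
    rw [Real.norm_eq_abs] at h2
    rw [hx] at h1
    rw [← sq_abs]
    nlinarith

end FreePhase

/-! ### The free Schrödinger group on L² and on Schwartz functions -/

section FreeGroup

/-- Multiplication by `exp(itp²)` on `L²(ℝ)`. -/
def phaseMul (t : ℝ) : L2 →L[ℂ] L2 :=
  (ContinuousLinearMap.mul ℂ ℂ).holderL volume ∞ 2 2 (memLp_freePhase t).toLp

theorem coeFn_phaseMul (t : ℝ) (f : L2) :
    phaseMul t f =ᵐ[volume] fun ξ => freePhase t ξ * f ξ := by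
  have h1 := (ContinuousLinearMap.mul ℂ ℂ).coeFn_holder (r := 2) (memLp_freePhase t).toLp f
  filter_upwards [h1, (memLp_freePhase t).coeFn_toLp] with ξ h1 h2
  rw [h2] at h1
  exact h1

theorem phaseMul_zero : phaseMul 0 = 1 := by
  ext1 f
  refine Lp.ext ?_
  filter_upwards [coeFn_phaseMul 0 f] with ξ h
  rw [h, freePhase_zero, one_mul, one_apply_eq_self]

theorem phaseMul_add (s t : ℝ) : phaseMul (s + t) = phaseMul s ∘L phaseMul t := by
  ext1 f
  refine Lp.ext ?_
  filter_upwards [coeFn_phaseMul (s + t) f, coeFn_phaseMul s (phaseMul t f),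
    coeFn_phaseMul t f] with ξ h1 h2 h3
  rw [h1, ContinuousLinearMap.comp_apply, h2, h3, freePhase_add, mul_assoc]

theorem norm_phaseMul (t : ℝ) (f : L2) : ‖phaseMul t f‖ = ‖f‖ := by
  refine le_antisymm (Lp.norm_le_norm_of_ae_le ?_) (Lp.norm_le_norm_of_ae_le ?_) <;>
  · filter_upwards [coeFn_phaseMul t f] with ξ h
    rw [h, norm_mul, norm_freePhase, one_mul]

theorem freeGroup_apply (t : ℝ) (f : L2) :
    freeGroup t f = (Lp.fourierTransformₗᵢ ℝ ℂ).symm (phaseMul t (Lp.fourierTransformₗᵢ ℝ ℂ f)) :=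
  rfl

/-- The embedding of the Schwartz space into `L²(ℝ)`. -/
def schwartzEmbedding : 𝓢(ℝ, ℂ) →ₗ[ℂ] L2 := (toLpCLM ℂ (E := ℝ) ℂ 2 volume).toLinearMap

theorem coeFn_schwartzEmbedding (Φ : 𝓢(ℝ, ℂ)) : schwartzEmbedding Φ =ᵐ[volume] Φ :=
  Φ.coeFn_toLp 2 volume

theorem fourier_schwartzEmbedding (Φ : 𝓢(ℝ, ℂ)) :
    Lp.fourierTransformₗᵢ ℝ ℂ (schwartzEmbedding Φ) = schwartzEmbedding (𝓕 Φ) :=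
  SchwartzMap.toLp_fourier_eq Φ

theorem fourierInv_schwartzEmbedding (Φ : 𝓢(ℝ, ℂ)) :
    (Lp.fourierTransformₗᵢ ℝ ℂ).symm (schwartzEmbedding Φ) = schwartzEmbedding (𝓕⁻ Φ) :=
  SchwartzMap.toLp_fourierInv_eq Φ

theorem denseRange_schwartzEmbedding : DenseRange schwartzEmbedding :=
  denseRange_toLpCLM ENNReal.ofNat_ne_top

/-- The free evolution on Schwartz functions. -/
def freeSchwartz (t : ℝ) (Φ : 𝓢(ℝ, ℂ)) : 𝓢(ℝ, ℂ) := fourierMultiplierCLM ℂ (freePhase t) Φ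

theorem schwartzEmbedding_freeSchwartz (t : ℝ) (Φ : 𝓢(ℝ, ℂ)) :
    schwartzEmbedding (freeSchwartz t Φ) = freeGroup t (schwartzEmbedding Φ) := by
  rw [freeGroup_apply, fourier_schwartzEmbedding, freeSchwartz, fourierMultiplierCLM_apply,
    ← fourierInv_schwartzEmbedding]
  congr 1
  refine Lp.ext ?_
  filter_upwards [coeFn_phaseMul t (schwartzEmbedding (𝓕 Φ)), coeFn_schwartzEmbedding (𝓕 Φ),
    coeFn_schwartzEmbedding (smulLeftCLM ℂ (freePhase t) (𝓕 Φ))] with ξ h1 h2 h3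
  rw [h1, h2, h3, smulLeftCLM_apply_apply (hasTemperateGrowth_freePhase t), smul_eq_mul]

theorem fourier_momentum (Φ : 𝓢(ℝ, ℂ)) (ξ : ℝ) :
    𝓕 (momentum Φ) ξ = ((2 * Real.pi * ξ : ℝ) : ℂ) * 𝓕 Φ ξ := by
  have h1 : derivCLM ℂ ℂ Φ = LineDeriv.lineDerivOp (1 : ℝ) Φ := by
    ext x
    rw [derivCLM_apply, lineDerivOp_apply_eq_fderiv, fderiv_apply_one_eq_deriv]
  have h2 : momentum Φ = (-Complex.I) • LineDeriv.lineDerivOp (1 : ℝ) Φ := by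
    rw [← h1]; rfl
  have hg : Function.HasTemperateGrowth fun x : ℝ => inner ℝ x (1 : ℝ) := by fun_prop
  rw [h2, FourierTransform.fourier_smul, fourier_lineDerivOp_eq, smul_apply,
    smul_apply, smulLeftCLM_apply_apply hg]
  simp only [smul_eq_mul, Complex.real_smul]
  simp
  linear_combination (-(2 * Real.pi * ξ : ℂ) * 𝓕 Φ ξ) * Complex.I_mul_I

/-- The pointwise Taylor remainder is at most `2t²p⁴|f|`. As `p⁴f` is again Schwartz, the remainder
in L² is `O(t²)`. -/
theorem hasDerivAt_phaseMul {f f₂ f₄ : 𝓢(ℝ, ℂ)}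
    (h₂ : ∀ ξ, f₂ ξ = (((2 * Real.pi * ξ) ^ 2 : ℝ) : ℂ) * f ξ)
    (h₄ : ∀ ξ, f₄ ξ = (((2 * Real.pi * ξ) ^ 4 : ℝ) : ℂ) * f ξ) :
    HasDerivAt (fun t => phaseMul t (schwartzEmbedding f))
      (Complex.I • schwartzEmbedding f₂) 0 := by
  rw [hasDerivAt_iff_isLittleO]
  have hbound : ∀ t : ℝ, ‖phaseMul t (schwartzEmbedding f) - phaseMul 0 (schwartzEmbedding f) -
      (t - 0) • Complex.I • schwartzEmbedding f₂‖ ≤ (2 * ‖schwartzEmbedding f₄‖) * ‖t ^ 2‖ := by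
    intro t
    have : (2 * ‖schwartzEmbedding f₄‖) * ‖t ^ 2‖ = (2 * t ^ 2) * ‖schwartzEmbedding f₄‖ := by
      rw [Real.norm_eq_abs, abs_of_nonneg (sq_nonneg t)]; ring
    have hs : t • Complex.I • schwartzEmbedding f₂ =
        ((t : ℂ) * Complex.I) • schwartzEmbedding f₂ := by
      rw [RCLike.real_smul_eq_coe_smul (K := ℂ) t, smul_smul]; rfl
    rw [this, phaseMul_zero, one_apply_eq_self, sub_zero, hs]
    refine Lp.norm_le_mul_norm_of_ae_le_mul ?_
    filter_upwards [coeFn_phaseMul t (schwartzEmbedding f), coeFn_schwartzEmbedding f,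
      coeFn_schwartzEmbedding f₂, coeFn_schwartzEmbedding f₄,
      Lp.coeFn_sub (phaseMul t (schwartzEmbedding f) - schwartzEmbedding f)
        (((t : ℂ) * Complex.I) • schwartzEmbedding f₂),
      Lp.coeFn_sub (phaseMul t (schwartzEmbedding f)) (schwartzEmbedding f),
      Lp.coeFn_smul ((t : ℂ) * Complex.I) (schwartzEmbedding f₂)] with ξ e1 e2 e3 e4 e5 e6 e7
    rw [e5, Pi.sub_apply, e6, Pi.sub_apply, e7, Pi.smul_apply, e1, e2, e3, e4, h₂, h₄, smul_eq_mul]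
    have hle := norm_exp_I_mul_sub_le (t * (2 * Real.pi * ξ) ^ 2)
    have e : freePhase t ξ * f ξ - f ξ -
        (t : ℂ) * Complex.I * ((((2 * Real.pi * ξ) ^ 2 : ℝ) : ℂ) * f ξ) =
        (Complex.exp (Complex.I * ((t * (2 * Real.pi * ξ) ^ 2 : ℝ) : ℂ)) - 1 -
          Complex.I * ((t * (2 * Real.pi * ξ) ^ 2 : ℝ) : ℂ)) * f ξ := by
      rw [freePhase]
      push_cast
      ring
    rw [e, norm_mul, norm_mul, Complex.norm_real, Real.norm_eq_abs,
      abs_of_nonneg (by positivity : (0 : ℝ) ≤ (2 * Real.pi * ξ) ^ 4), ← mul_assoc]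
    gcongr
    refine hle.trans (le_of_eq ?_)
    ring
  have h0 : (fun t : ℝ => phaseMul t (schwartzEmbedding f) - phaseMul 0 (schwartzEmbedding f) -
      (t - 0) • Complex.I • schwartzEmbedding f₂) =O[nhds 0] fun t : ℝ => t ^ 2 :=
    Asymptotics.IsBigO.of_bound _ (Filter.Eventually.of_forall hbound)
  simpa using h0.trans_isLittleO (Asymptotics.isLittleO_pow_id one_lt_two)

theorem hasDerivAt_freeGroup (Φ : 𝓢(ℝ, ℂ)) :
    HasDerivAt (fun t => freeGroup t (schwartzEmbedding Φ))
      (Complex.I • schwartzEmbedding (momentum (momentum Φ))) 0 := by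
  have h1 : HasDerivAt (fun t => phaseMul t (schwartzEmbedding (𝓕 Φ)))
      (Complex.I • schwartzEmbedding (𝓕 (momentum (momentum Φ)))) 0 := by
    refine hasDerivAt_phaseMul (f₄ := 𝓕 (momentum (momentum (momentum (momentum Φ)))))
      (fun ξ => ?_) fun ξ => ?_
    all_goals
      simp only [fourier_momentum]
      push_cast
      ring
  have h2 := (((Lp.fourierTransformₗᵢ ℝ ℂ).symm.toContinuousLinearEquiv.toContinuousLinearMap :
    L2 →L[ℂ] L2).restrictScalars ℝ).hasFDerivAt.comp_hasDerivAt (0 : ℝ) h1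
  have e1 : (Lp.fourierTransformₗᵢ ℝ ℂ).symm
      (Complex.I • schwartzEmbedding (𝓕 (momentum (momentum Φ)))) =
      Complex.I • schwartzEmbedding (momentum (momentum Φ)) := by
    rw [map_smul, ← fourier_schwartzEmbedding, LinearIsometryEquiv.symm_apply_apply]
  rw [← e1]
  refine HasDerivAt.congr_of_eventuallyEq h2 (Filter.Eventually.of_forall fun t => ?_)
  simp only [freeGroup_apply, fourier_schwartzEmbedding]
  rfl

theorem isFreeEvolution_freeGroup :
    IsFreeEvolution schwartzEmbedding (momentum ∘ₗ momentum) freeGroup freeSchwartz := by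
  have h0 : freeGroup 0 = 1 := by
    ext1 f
    rw [freeGroup_apply, phaseMul_zero, one_apply_eq_self, LinearIsometryEquiv.symm_apply_apply,
      one_apply_eq_self]
  have hadd : ∀ s t, freeGroup (s + t) = freeGroup s ∘L freeGroup t := by
    intro s t
    ext1 f
    rw [ContinuousLinearMap.comp_apply, freeGroup_apply, freeGroup_apply, freeGroup_apply,
      LinearIsometryEquiv.apply_symm_apply, phaseMul_add, ContinuousLinearMap.comp_apply]
  have hnorm : ∀ t f, ‖freeGroup t f‖ = ‖f‖ := by
    intro t f
    rw [freeGroup_apply, LinearIsometryEquiv.norm_map, norm_phaseMul, LinearIsometryEquiv.norm_map]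
  have hinner : ∀ t f f', inner ℂ (freeGroup t f) (freeGroup t f') = inner ℂ f f' := fun t =>
    (⟨(freeGroup t).toLinearMap, hnorm t⟩ : L2 →ₗᵢ[ℂ] L2).inner_map_map
  have hadj : ∀ t, star (freeGroup t) = freeGroup (-t) := by
    intro t
    rw [ContinuousLinearMap.star_eq_adjoint]
    refine ((ContinuousLinearMap.eq_adjoint_iff _ _).2 fun x y => ?_).symm
    rw [← hinner t, ← ContinuousLinearMap.comp_apply, ← hadd, add_neg_cancel, h0,
      one_apply_eq_self]
  refine ⟨⟨h0, hadd, fun t => ?_, ?_⟩, denseRange_schwartzEmbedding, injective_toLp 2 volume,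
    schwartzEmbedding_freeSchwartz, hasDerivAt_freeGroup⟩
  · rw [Unitary.mem_iff, hadj, ContinuousLinearMap.mul_def, ContinuousLinearMap.mul_def, ← hadd,
      ← hadd]
    simp [h0]
  · refine continuous_of_dense hadd hnorm denseRange_schwartzEmbedding ?_
    rintro _ ⟨Φ, rfl⟩
    have := (hasDerivAt_freeGroup Φ).continuousAt.tendsto
    rwa [h0, one_apply_eq_self] at this

end FreeGroup

/-! ### The concrete Hamiltonian as an instance of the abstract setting -/

section Hamiltonian

variable {V : ℝ → ℝ} (hV : DefinedOnSchwartz V)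

/-- Multiplication by `V` as a linear map from the Schwartz space to `L²(ℝ)`. -/
def potentialMap : 𝓢(ℝ, ℂ) →ₗ[ℂ] L2 where
  toFun Φ := (hV Φ).toLp
  map_add' Φ Ψ := by
    rw [← MemLp.toLp_add]
    apply MemLp.toLp_congr
    filter_upwards with x
    simp [mul_add]
  map_smul' c Φ := by
    rw [RingHom.id_apply, ← MemLp.toLp_const_smul]
    apply MemLp.toLp_congr
    filter_upwards with x
    simp [mul_left_comm]

theorem inner_potentialMap (Φ Ψ : 𝓢(ℝ, ℂ)) :
    inner ℂ (schwartzEmbedding Ψ) (potentialMap hV Φ) =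
      inner ℂ (potentialMap hV Ψ) (schwartzEmbedding Φ) := by
  rw [L2.inner_def, L2.inner_def]
  refine integral_congr_ae ?_
  filter_upwards [coeFn_schwartzEmbedding Ψ, coeFn_schwartzEmbedding Φ, (hV Φ).coeFn_toLp,
    (hV Ψ).coeFn_toLp] with x h1 h2 h3 h4
  have h3' : potentialMap hV Φ x = V x * Φ x := h3
  have h4' : potentialMap hV Ψ x = V x * Ψ x := h4
  rw [h1, h2, h3', h4']
  simp only [RCLike.inner_apply, map_mul, Complex.conj_ofReal]
  ring

theorem mem_domain_onSchwartz (T : 𝓢(ℝ, ℂ) →ₗ[ℂ] L2) (Φ : 𝓢(ℝ, ℂ)) :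
    schwartzEmbedding Φ ∈ (onSchwartz T).domain :=
  ⟨Φ, rfl⟩

theorem onSchwartz_apply (T : 𝓢(ℝ, ℂ) →ₗ[ℂ] L2) (Φ : 𝓢(ℝ, ℂ)) (x : (onSchwartz T).domain)
    (hx : (x : L2) = schwartzEmbedding Φ) : onSchwartz T x = T Φ := by
  change T ((LinearEquiv.ofInjective (toLpCLM ℂ (E := ℝ) ℂ 2 volume).toLinearMap
    (injective_toLp 2 volume)).symm x) = T Φ
  exact congrArg T ((LinearEquiv.symm_apply_eq _).2 (Subtype.ext hx))

theorem mem_graph_hamiltonian_iff (p : L2 × L2) :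
    p ∈ (hamiltonian V hV).graph ↔ ∃ Φ, (schwartzEmbedding Φ,
      schwartzEmbedding ((momentum ∘ₗ momentum) Φ) + potentialMap hV Φ) = p := by
  have hval : ∀ (Φ : 𝓢(ℝ, ℂ)) (x : (hamiltonian V hV).domain),
      (x : L2) = schwartzEmbedding Φ → hamiltonian V hV x =
        schwartzEmbedding ((momentum ∘ₗ momentum) Φ) + potentialMap hV Φ := by
    intro Φ x hx
    refine (LinearPMap.add_apply _ _ x).trans ?_
    exact congrArg₂ (· + ·) (onSchwartz_apply _ Φ _ hx) (onSchwartz_apply _ Φ _ hx)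
  rw [LinearPMap.mem_graph_iff]
  constructor
  · rintro ⟨x, h1, h2⟩
    obtain ⟨Φ, hΦ⟩ := x.2.1
    refine ⟨Φ, Prod.ext (hΦ.trans h1) ?_⟩
    rw [← h2, hval Φ x hΦ.symm]
  · rintro ⟨Φ, rfl⟩
    exact ⟨⟨schwartzEmbedding Φ, mem_domain_onSchwartz _ Φ, mem_domain_onSchwartz _ Φ⟩, rfl,
      hval Φ _ rfl⟩

/-- Used with `f` the freely evolved L² class of a Schwartz function: it identifies the integrand of
the hypothesis with the abstract `v (g (-s) Φ)`. -/
theorem enorm_potentialMap (Φ : 𝓢(ℝ, ℂ)) {f : L2} (hf : schwartzEmbedding Φ = f) :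
    ‖potentialMap hV Φ‖ₑ = eLpNorm (fun x => (V x : ℂ) * f x) 2 volume := by
  refine (Lp.enorm_toLp (hf := hV Φ)).trans (eLpNorm_congr_ae ?_)
  filter_upwards [coeFn_schwartzEmbedding Φ] with x h
  rw [← hf, h]

end Hamiltonian

end SchrodingerPerturbation

end

theorem lemma6p1 (V : ℝ → ℝ) (hV : SchrodingerPerturbation.DefinedOnSchwartz V)
    (C : ℝ → SchrodingerPerturbation.L2 →L[ℂ] SchrodingerPerturbation.L2)
    (hC : ∀ t : ℝ, 0 ≤ t → IsCompactOperator (C t))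
    (hVC : ∀ t : ℝ, 0 ≤ t → ∀ Φ : 𝓢(ℝ, ℂ),
      ∫⁻ s in Set.Icc 0 t,
          eLpNorm (fun x => (V x : ℂ) *
            SchrodingerPerturbation.freeGroup (-s) (Φ.toLp 2 volume) x) 2 volume ^ 2
        ≤ ‖C t (Φ.toLp 2 volume)‖ₑ ^ 2) :
    SchrodingerPerturbation.IsEssentiallySelfAdjoint
        (SchrodingerPerturbation.hamiltonian V hV) ∧
      (∃! U : ℝ → SchrodingerPerturbation.L2 →L[ℂ] SchrodingerPerturbation.L2,
        SchrodingerPerturbation.IsExpGroup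
          (SchrodingerPerturbation.hamiltonian V hV).closure U) ∧
      ∀ U : ℝ → SchrodingerPerturbation.L2 →L[ℂ] SchrodingerPerturbation.L2,
        SchrodingerPerturbation.IsExpGroup
            (SchrodingerPerturbation.hamiltonian V hV).closure U →
          ∀ t : ℝ, IsCompactOperator
            (U t ∘L SchrodingerPerturbation.freeGroup (-t) - 1 :
              SchrodingerPerturbation.L2 →L[ℂ] SchrodingerPerturbation.L2) := by
  open SchrodingerPerturbation in
  have hF := isFreeEvolution_freeGroup
  have hb : ∀ t : ℝ, 0 ≤ t → ∀ Φ,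
      ∫⁻ s in Set.Icc (0 : ℝ) t, ‖potentialMap hV (freeSchwartz (-s) Φ)‖ₑ ^ 2 ≤
        ‖C t (schwartzEmbedding Φ)‖ₑ ^ 2 := by
    intro t ht Φ
    simp only [enorm_potentialMap hV _ (hF.map_eq _ Φ)]
    exact hVC t ht Φ
  -- For the relative bound only the boundedness of `C 1` matters, not its compactness.
  obtain ⟨b, hrel⟩ := hF.exists_relative_bound (inner_potentialMap hV) (norm_nonneg (C 1))
    fun Φ => by
      refine (hb 1 zero_le_one Φ).trans ?_
      rw [← ofReal_norm]
      gcongr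
      exact (C 1).le_opNorm _
  have hA := mem_graph_hamiltonian_iff hV
  have hess := hF.isEssentiallySelfAdjoint (inner_potentialMap hV) hA hrel
  exact ⟨hess, existsUnique_isExpGroup hess.2, fun U hU t =>
    hF.isCompactOperator_wave_sub hA hC hb hrel hU t⟩
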